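/- Let $\mathcal M$ be a smooth finite-dimensional Riemannian manifold without boundary, with geodesic distance $d$, and let $\mathcal X\subset\mathcal M$ be compact and geodesically convex: any two points $x,y\in\mathcal X$ are joined by exactly one length-minimizing geodesic $\gamma_{x,y}:[0,1]\to\mathcal M$ that stays in $\mathcal X$. Write $\mathrm{Exp}_x^{-1}(y)=\dot\gamma_{x,y}(0)\in T_x\mathcal M$. Let $P$ be a probability measure on a measurable space $\Xi$, let $\phi:\mathcal M\times\Xi\to\mathbb R$ with $\phi(x,\cdot)$ integrable for every $x$, and let $\Phi(x)=\mathbb E_{\xi\sim P}[\phi(x,\xi)]$. Assume: (1) $\Phi$ is differentiable at the points of $\mathcal X$ and $L$-smooth on $\mathcal X$, i.e. $\|\mathrm{grad}\,\Phi(y)-\Gamma_x^y\,\mathrm{grad}\,\Phi(x)\|\le L\,d(x,y)$ for all $x,y\in\mathcal X$, where $\Gamma_x^y$ is parallel transport along $\gamma_{x,y}$; (2) for every $x\in\mathcal X$ and $P$-almost every $\xi$, $\phi(\cdot,\xi)$ is differentiable at $x$ with $\|\mathrm{grad}\,\phi(x,\xi)\|\le C$; the map $(x,\xi)\mapsto\mathrm{grad}\,\phi(x,\xi)$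 is measurable on $\mathcal X\times\Xi$, and it is unbiased: $\mathbb E_{\xi}[\mathrm{grad}\,\phi(x,\xi)]=\mathrm{grad}\,\Phi(x)$ for $x\in\mathcal X$. The stochastic Riemannian Frank-Wolfe method (SRFW) with $K$ iterations, batch sizes $b_k$ and step sizes $\eta_k$ starts at some $x_0\in\mathcal X$. For $k=0,\dots,K-1$ it draws $\xi_{k,1},\dots,\xi_{k,b_k}$ i.i.d. from $P$, independently of the past; calls the stochastic first-order oracle (SFO) once at $x_k$ with each of these samples, which gives $g_k=\frac1{b_k}\sum_{i=1}^{b_k}\mathrm{grad}\,\phi(x_k,\xi_{k,i})$; calls the Riemannian linear oracle (RLO) once, which returns some $y_k\in\operatorname{argmin}_{y\in\mathcal X}\langle g_k,\mathrm{Exp}_{x_k}^{-1}(y)\rangle$; and sets $x_{k+1}=\gamma_{x_k,y_k}(\eta_k)$. (The iterates $x_k$ and the oracle answers $y_k$ are random variables.) The output $\hat x$ is drawn uniformly at random from $x_0,\dots,x_{K-1}$, independently of everything else. Let $\mathcal G(x)=\max_{y\in\mathcal X}\langle \mathrm{Exp}_x^{-1}(y),-\mathrm{grad}\,\Phi(x)\rangle$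 be the Frank-Wolfe gap. Then SRFW finds an $\epsilon$-accurate solution with $O(1/\epsilon^4)$ SFO calls and $O(1/\epsilon^2)$ RLO calls. Precisely: there is a constant $A$, depending only on the problem $(\mathcal M,\mathcal X,\phi,P,L,C)$, such that for every $\epsilon\in(0,1]$ there is a $K\ge1$ for which every execution of SRFW with $K$ iterations, $b_k=K$ and $\eta_k=1/\sqrt K$ satisfies $\mathbb E[\mathcal G(\hat x)]\le\epsilon$, makes at most $A/\epsilon^4$ SFO calls, and makes at most $A/\epsilon^2$ RLO calls. -/

import Mathlib

open Set MeasureTheory ProbabilityTheory Bundle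
open scoped Manifold ContDiff ENNReal Bundle

noncomputable section

namespace SRFW

section Geometry

variable {E : Type*} [NormedAddCommGroup E] [NormedSpace ℝ E] [FiniteDimensional ℝ E]
  {M : Type*} [EMetricSpace M] [ChartedSpace E M] [IsManifold 𝓘(ℝ, E) ∞ M]
  [RiemannianBundle (fun x : M => TangentSpace 𝓘(ℝ, E) x)]

instance instCompleteTangent (x : M) : CompleteSpace (TangentSpace 𝓘(ℝ, E) x) :=
  haveI : FiniteDimensional ℝ (TangentSpace 𝓘(ℝ, E) x) := inferInstanceAs (FiniteDimensional ℝ E)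
  FiniteDimensional.complete ℝ _

/-- The Riemannian gradient: the vector of `T_x M` that represents the differential of `f` at `x`
through the inner product of `T_x M`. -/
def grad (f : M → ℝ) (x : M) : TangentSpace 𝓘(ℝ, E) x :=
  (InnerProductSpace.toDual ℝ (TangentSpace 𝓘(ℝ, E) x)).symm (mfderiv 𝓘(ℝ, E) 𝓘(ℝ, ℝ) f x)

/-- The components `g_z(v, w)` of the metric in the preferred chart at `p`, at the point of `M` with
coordinates `z`; `v` and `w` are coordinate vectors. -/
def metricCoeff (p : M) (z v w : E) : ℝ :=
  inner ℝ
    ((trivializationAt E (fun x : M => TangentSpace 𝓘(ℝ, E) x) p).symmL ℝ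
      ((extChartAt 𝓘(ℝ, E) p).symm z) v)
    ((trivializationAt E (fun x : M => TangentSpace 𝓘(ℝ, E) x) p).symmL ℝ
      ((extChartAt 𝓘(ℝ, E) p).symm z) w)

/-- Christoffel symbols of the first kind of the Levi-Civita connection in the chart at `p`:
`½ (∂_u g(v, w) + ∂_v g(u, w) - ∂_w g(u, v))`, which equals `g(∇_u v, w)` for the constant
coordinate fields `u`, `v`, `w`. -/
def christoffel (p : M) (z u v w : E) : ℝ :=
  (fderiv ℝ (fun z' => metricCoeff p z' v w) z u
    + fderiv ℝ (fun z' => metricCoeff p z' u w) z v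
    - fderiv ℝ (fun z' => metricCoeff p z' u v) z w) / 2

/-- Coordinates, in the chart at `p`, of a tangent vector. -/
def coord (p : M) (v : TangentBundle 𝓘(ℝ, E) M) : E :=
  (trivializationAt E (fun x : M => TangentSpace 𝓘(ℝ, E) x) p v).2

/-- The velocity of a curve parametrized by `[0, 1]`. -/
def velocity (γ : ℝ → M) (t : ℝ) : TangentSpace 𝓘(ℝ, E) (γ t) :=
  mfderivWithin 𝓘(ℝ, ℝ) 𝓘(ℝ, E) γ (Icc 0 1) t (1 : ℝ)

/-- `V` is a parallel vector field along `γ : [0, 1] → M`: its Levi-Civita covariant derivative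
along `γ` vanishes. The equation `V' + Γ(γ', V) = 0` is tensorial; at time `t` it is written in the
chart at `γ t`, and it is paired with an arbitrary coordinate vector `w`. -/
def IsParallelAlong (γ : ℝ → M) (V : ∀ t, TangentSpace 𝓘(ℝ, E) (γ t)) : Prop :=
  ∀ t ∈ Icc (0 : ℝ) 1, ∃ a : E,
    HasDerivWithinAt (fun s => coord (γ t) ⟨γ s, V s⟩) a (Icc 0 1) t ∧
    ∀ w : E,
      metricCoeff (γ t) (extChartAt 𝓘(ℝ, E) (γ t) (γ t)) a w
        + christoffel (γ t) (extChartAt 𝓘(ℝ, E) (γ t) (γ t))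
            (coord (γ t) ⟨γ t, velocity γ t⟩) (coord (γ t) ⟨γ t, V t⟩) w = 0

variable (E) in
/-- `γ : [0, 1] → M` is a (constant speed) geodesic: its velocity is parallel along it. -/
def IsGeodesic (γ : ℝ → M) : Prop :=
  MDifferentiableOn 𝓘(ℝ, ℝ) 𝓘(ℝ, E) γ (Icc 0 1) ∧ IsParallelAlong (E := E) γ (velocity γ)

variable (E) in
/-- `γ` is a length-minimizing geodesic of `M` from `x` to `y`, parametrized by `[0, 1]`, that stays
in `X`. -/
structure IsMinGeodesicIn (X : Set M) (γ : ℝ → M) (x y : M) : Prop where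
  source : γ 0 = x
  target : γ 1 = y
  geodesic : IsGeodesic E γ
  minimizing : Manifold.pathELength 𝓘(ℝ, E) γ 0 1 = edist x y
  mem : ∀ t ∈ Icc (0 : ℝ) 1, γ t ∈ X

variable (E) in
/-- Geodesic convexity: any two points of `X` are joined by exactly one minimizing geodesic in `X`
(so that the inverse exponential map and the geodesic map are well defined on `X`). -/
def IsGeodesicallyConvex (X : Set M) : Prop :=
  ∀ x ∈ X, ∀ y ∈ X, ∃ γ : ℝ → M, IsMinGeodesicIn E X γ x y ∧
    ∀ γ' : ℝ → M, IsMinGeodesicIn E X γ' x y → EqOn γ' γ (Icc 0 1)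

/-- `v = Exp_x⁻¹(y)`: the vector `v ∈ T_x M` is the initial velocity of the minimizing geodesic in
`X` from `x` to `y`. -/
def IsExpInv (X : Set M) (x y : M) (v : TangentSpace 𝓘(ℝ, E) x) : Prop :=
  ∃ γ : ℝ → M, IsMinGeodesicIn E X γ x y ∧
    (⟨γ 0, velocity γ 0⟩ : TangentBundle 𝓘(ℝ, E) M) = ⟨x, v⟩

open Classical in
/-- The inverse exponential map `Exp_x⁻¹(y)` for `x, y` in a geodesically convex set `X`. -/
def expInv (X : Set M) (x y : M) : TangentSpace 𝓘(ℝ, E) x :=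
  if h : ∃ v : TangentSpace 𝓘(ℝ, E) x, IsExpInv X x y v then h.choose else 0

variable (E) in
/-- `Φ` is (geodesically) `L`-smooth on `X`: it is differentiable at the points of `X`, and
`‖grad Φ(y) - Γ_x^y grad Φ(x)‖ ≤ L d(x, y)` for `x, y ∈ X`. Here `Γ_x^y` is parallel transport along
the minimizing geodesic `γ` from `x` to `y`: `Γ_x^y grad Φ(x) = V 1` for the parallel field `V` along
`γ` with `V 0 = grad Φ(x)`. -/
def IsLSmoothOn (X : Set M) (Φ : M → ℝ) (L : ℝ) : Prop :=
  (∀ x ∈ X, MDifferentiableAt 𝓘(ℝ, E) 𝓘(ℝ, ℝ) Φ x) ∧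
  ∀ x ∈ X, ∀ y ∈ X, ∃ (γ : ℝ → M) (V : ∀ t, TangentSpace 𝓘(ℝ, E) (γ t)),
    IsMinGeodesicIn E X γ x y ∧ IsParallelAlong γ V ∧ V 0 = grad Φ (γ 0) ∧
      ‖grad Φ (γ 1) - V 1‖ ≤ L * (edist x y).toReal

variable (E) in
/-- The Frank-Wolfe gap `max_{y ∈ X} ⟨Exp_x⁻¹(y), -grad Φ(x)⟩`. -/
def fwGap (X : Set M) (Φ : M → ℝ) (x : M) : ℝ :=
  ⨆ y : X, inner ℝ (expInv (E := E) X x y) (-grad Φ x)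

/-- `y` is an admissible answer of the Riemannian linear oracle to the query `(x, g)`:
`y ∈ argmin_{z ∈ X} ⟨g, Exp_x⁻¹(z)⟩`. -/
def IsRLOAnswer (X : Set M) (x : M) (g : TangentSpace 𝓘(ℝ, E) x) (y : M) : Prop :=
  y ∈ X ∧ ∀ z ∈ X, inner ℝ g (expInv X x y) ≤ inner ℝ g (expInv X x z)

variable (E M) in
/-- A call to one of the two oracles. `sfo x ξ` queries the stochastic first-order oracle at `x`, the
oracle using the sample `ξ`; `rlo x g` queries the Riemannian linear oracle at `x` with direction
`g`. -/
inductive OracleCall (Ξ : Type*)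
  | sfo (x : M) (ξ : Ξ) : OracleCall Ξ
  | rlo (x : M) (g : TangentSpace 𝓘(ℝ, E) x) : OracleCall Ξ

/-- Is the call a call to the stochastic first-order oracle (otherwise: to the linear oracle)? -/
def OracleCall.isSFO {Ξ : Type*} : OracleCall E M Ξ → Bool
  | .sfo _ _ => true
  | .rlo _ _ => false

/-- The minibatch gradient `(1/b) ∑_{i < b} grad φ(x, ξ_i)`. -/
def batchGrad {Ξ : Type*} (φ : M → Ξ → ℝ) {b : ℕ} (ξ : Fin b → Ξ) (x : M) :
    TangentSpace 𝓘(ℝ, E) x :=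
  (b : ℝ)⁻¹ • ∑ i, grad (fun z => φ z (ξ i)) x

variable (E) in
/-- An execution of the stochastic Riemannian Frank-Wolfe method on a probability space `(Ω, μ)`,
with `K` iterations, batch sizes `b k` and step sizes `η k`. Iteration `k` draws
`ξ k 0, …, ξ k (b k - 1)` i.i.d. from `P`, independently of the past `ℱ k`, receives from the linear
oracle a point `y k`, and moves from `x k` to the point with parameter `η k` of the geodesic to `y k`.
The output is `x J` for a uniformly distributed index `J`, independent of the iterations. -/
structure Run [MeasurableSpace M] {Ξ : Type*} [MeasurableSpace Ξ] (X : Set M) (φ : M → Ξ → ℝ)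
    (P : Measure Ξ) (K : ℕ) (b : ℕ → ℕ) (η : ℕ → ℝ)
    {Ω : Type*} [mΩ : MeasurableSpace Ω] (μ : Measure Ω) where
  ξ : ∀ k : ℕ, Fin (b k) → Ω → Ξ
  x : ℕ → Ω → M
  y : ℕ → Ω → M
  J : Ω → Fin K
  ℱ : Filtration ℕ mΩ
  measurable_x : ∀ k ≤ K, Measurable[ℱ k] (x k)
  measurable_y : ∀ k < K, Measurable[ℱ (k + 1)] (y k)
  measurable_ξ : ∀ k < K, ∀ i, Measurable[ℱ (k + 1)] (ξ k i)
  law_ξ : ∀ k < K, ∀ i, μ.map (ξ k i) = P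
  iIndep_ξ : ∀ k < K, iIndepFun (ξ k) μ
  indep_past : ∀ k < K,
    Indep (MeasurableSpace.comap (fun o i => ξ k i o) MeasurableSpace.pi) (ℱ k) μ
  init : ∀ o, x 0 o ∈ X
  linear_oracle : ∀ k < K, ∀ o,
    IsRLOAnswer X (x k o) (batchGrad (E := E) φ (fun i => ξ k i o) (x k o)) (y k o)
  step : ∀ k < K, ∀ o, ∃ γ : ℝ → M,
    IsMinGeodesicIn E X γ (x k o) (y k o) ∧ x (k + 1) o = γ (η k)
  measurable_J : Measurable J
  uniform_J : ∀ j, μ (J ⁻¹' {j}) = (K : ℝ≥0∞)⁻¹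
  indep_J : Indep (MeasurableSpace.comap J ⊤) (ℱ K) μ

namespace Run

variable [MeasurableSpace M] {Ξ : Type*} [MeasurableSpace Ξ] {X : Set M} {φ : M → Ξ → ℝ}
  {P : Measure Ξ} {K : ℕ} {b : ℕ → ℕ} {η : ℕ → ℝ}
  {Ω : Type*} [MeasurableSpace Ω] {μ : Measure Ω}

/-- The output of the method. -/
def output (r : Run E X φ P K b η μ) (o : Ω) : M := r.x (r.J o) o

/-- The oracle calls of iteration `k`, in order. -/
def callsAt (r : Run E X φ P K b η μ) (o : Ω) (k : ℕ) : List (OracleCall E M Ξ) :=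
  List.ofFn (fun i => OracleCall.sfo (r.x k o) (r.ξ k i o)) ++
    [OracleCall.rlo (r.x k o) (batchGrad φ (fun i => r.ξ k i o) (r.x k o))]

/-- All oracle calls of the execution, in order. -/
def transcript (r : Run E X φ P K b η μ) (o : Ω) : List (OracleCall E M Ξ) :=
  (List.range K).flatMap (r.callsAt o)

/-- The number of calls to the stochastic first-order oracle. -/
def sfoCalls (r : Run E X φ P K b η μ) (o : Ω) : ℕ :=
  (r.transcript o).countP fun c => c.isSFO

/-- The number of calls to the Riemannian linear oracle. -/
def rloCalls (r : Run E X φ P K b η μ) (o : Ω) : ℕ :=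
  (r.transcript o).countP fun c => !c.isSFO

end Run

end Geometry

end SRFW

end

noncomputable section

namespace SRFW

open Filter Topology

set_option linter.unusedSectionVars false

/-! ### Tangent vectors and the metric in charts. -/

section Geometry

variable {E : Type*} [NormedAddCommGroup E] [NormedSpace ℝ E] [FiniteDimensional ℝ E]
  {M : Type*} [EMetricSpace M] [ChartedSpace E M] [IsManifold 𝓘(ℝ, E) ∞ M]
  [RiemannianBundle (fun x : M => TangentSpace 𝓘(ℝ, E) x)]

/-! Write `f` for the expected objective and `D` for the diameter of `X`. Smoothness gives a
quadratic upper bound for `f` along the geodesic from `x k` to `y k`, whose squared speed is at most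
`D ^ 2` (`IsLSmoothOn.apply_le`). The linear oracle minimizes against the minibatch gradient, not
the true one; the swap costs `2 * D` times the gradient error (`fwGap_le_of_isRLOAnswer`). Together
(`fwGap_le_of_step`), the gap at `x k` is at most `(f (x k) - f (x (k+1))) / η + |L| D² η / 2 + 2 D
‖error‖`.

Averaged over `k` the first term telescopes, and the uniform independent index turns the average
into the expectation at the output (`lintegral_output_le`). The batch is independent of `x k`, so
the expected error is the mean error of `b` independent bounded vectors, of order `1 / √b`
(`lintegral_norm_batch_le`, `lintegral_batchError_le`). With `b = K` and `η = 1 / √K` every term is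
a constant over `√K`; hence `K` of order `1 / ε²` suffices, with `K` linear oracle calls and `K * K`
gradient calls.

The geometric input is metric compatibility, proved from the Christoffel formula: parallel fields
keep their inner products, so geodesics have constant speed, equal to the endpoint distance for
minimizing ones, and gradients can be compared along them. -/

lemma coord_eq_continuousLinearMapAt (p : M) {x : M} (hx : x ∈ (chartAt E p).source)
    (v : TangentSpace 𝓘(ℝ, E) x) :
    coord p ⟨x, v⟩ =
      (trivializationAt E (fun x : M => TangentSpace 𝓘(ℝ, E) x) p).continuousLinearMapAt ℝ x v := by
  rw [Trivialization.continuousLinearMapAt_apply, Trivialization.linearMapAt_apply, if_pos]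
  · rfl
  · simpa using hx

lemma symmL_coord (p : M) {x : M} (hx : x ∈ (chartAt E p).source)
    (v : TangentSpace 𝓘(ℝ, E) x) :
    (trivializationAt E (fun x : M => TangentSpace 𝓘(ℝ, E) x) p).symmL ℝ x (coord p ⟨x, v⟩) = v := by
  rw [coord_eq_continuousLinearMapAt p hx]
  exact Trivialization.symmL_continuousLinearMapAt _ (by simpa using hx) v

lemma coord_symmL (p : M) {x : M} (hx : x ∈ (chartAt E p).source) (u : E) :
    coord p ⟨x, (trivializationAt E (fun x : M => TangentSpace 𝓘(ℝ, E) x) p).symmL ℝ x u⟩ = u := by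
  rw [coord_eq_continuousLinearMapAt p hx]
  exact Trivialization.continuousLinearMapAt_symmL _ (by simpa using hx) u

lemma inner_eq_metricCoeff (p : M) {x : M} (hx : x ∈ (chartAt E p).source)
    (v w : TangentSpace 𝓘(ℝ, E) x) :
    inner ℝ v w =
      metricCoeff p (extChartAt 𝓘(ℝ, E) p x) (coord p ⟨x, v⟩) (coord p ⟨x, w⟩) := by
  have h : (extChartAt 𝓘(ℝ, E) p).symm (extChartAt 𝓘(ℝ, E) p x) = x :=
    (extChartAt 𝓘(ℝ, E) p).left_inv (by simpa using hx)
  rw [metricCoeff, h, symmL_coord p hx, symmL_coord p hx]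

/-- No chart-source hypothesis: the fibre part of the trivialization is a linear coordinate change
applied to `v`, even at points outside the chart. -/
lemma coord_smul (p x : M) (c : ℝ) (v : TangentSpace 𝓘(ℝ, E) x) :
    coord p ⟨x, c • v⟩ = c • coord p ⟨x, v⟩ := by
  simp only [coord, TangentBundle.trivializationAt_apply]
  exact map_smul _ c v

lemma metricCoeff_smul_left (p : M) (z v w : E) (c : ℝ) :
    metricCoeff p z (c • v) w = c * metricCoeff p z v w := by
  simp only [metricCoeff, map_smul, real_inner_smul_left]

lemma metricCoeff_smul_right (p : M) (z v w : E) (c : ℝ) :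
    metricCoeff p z v (c • w) = c * metricCoeff p z v w := by
  simp only [metricCoeff, map_smul, real_inner_smul_right]

lemma metricCoeff_comm (p : M) (z v w : E) : metricCoeff p z v w = metricCoeff p z w v := by
  simp only [metricCoeff, real_inner_comm]

/-- This quadratic scaling is what makes a linearly reparametrized geodesic a geodesic. -/
lemma christoffel_smul_smul (p : M) (z u v w : E) (c : ℝ) :
    christoffel p z (c • u) (c • v) w = c ^ 2 * christoffel p z u v w := by
  have h (f : E → ℝ) (c : ℝ) : fderiv ℝ (fun z => c * f z) z = c • fderiv ℝ f z :=
    congrFun (fderiv_const_smul_field (f := f) c) z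
  simp only [christoffel, metricCoeff_smul_left, metricCoeff_smul_right, h, map_smul,
    smul_apply, smul_eq_mul]
  ring

/-- In the trivialization at `p` the fibre part is the second projection near the point. The lemma
feeds the differentiability of the inner product on the bundle. -/
lemma mdifferentiableAt_symmL (p : M) (v : E) :
    MDifferentiableAt 𝓘(ℝ, E × E) (𝓘(ℝ, E).prod 𝓘(ℝ, E)) (fun q : E × E =>
      (⟨(extChartAt 𝓘(ℝ, E) p).symm q.1,
        (trivializationAt E (fun x : M => TangentSpace 𝓘(ℝ, E) x) p).symmL ℝ
          ((extChartAt 𝓘(ℝ, E) p).symm q.1) q.2⟩ : TangentBundle 𝓘(ℝ, E) M))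
      (extChartAt 𝓘(ℝ, E) p p, v) := by
  have hsymm : MDifferentiableAt 𝓘(ℝ, E × E) 𝓘(ℝ, E)
      (fun q : E × E => (extChartAt 𝓘(ℝ, E) p).symm q.1) (extChartAt 𝓘(ℝ, E) p p, v) := by
    have h1 : MDifferentiableAt 𝓘(ℝ, E) 𝓘(ℝ, E) (extChartAt 𝓘(ℝ, E) p).symm
        (extChartAt 𝓘(ℝ, E) p p) :=
      ((contMDiffOn_extChartAt_symm (n := 1) p).contMDiffAt
        (extChartAt_target_mem_nhds p)).mdifferentiableAt one_ne_zero
    have h2 : MDifferentiableAt 𝓘(ℝ, E × E) 𝓘(ℝ, E) (fun q : E × E => q.1)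
        (extChartAt 𝓘(ℝ, E) p p, v) := by
      rw [mdifferentiableAt_iff_differentiableAt]; fun_prop
    exact h1.comp (extChartAt 𝓘(ℝ, E) p p, v) h2
  rw [mdifferentiableAt_totalSpace]
  refine ⟨hsymm, ?_⟩
  simp only [extChartAt_to_inv]
  have h : MDifferentiableAt 𝓘(ℝ, E × E) 𝓘(ℝ, E) (fun q : E × E => q.2)
      (extChartAt 𝓘(ℝ, E) p p, v) := by
    rw [mdifferentiableAt_iff_differentiableAt]; fun_prop
  refine h.congr_of_eventuallyEq ?_
  have hmem : (chartAt E p).source ∈ 𝓝 ((extChartAt 𝓘(ℝ, E) p).symm (extChartAt 𝓘(ℝ, E) p p)) := by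
    rw [extChartAt_to_inv]
    exact chart_source_mem_nhds E p
  filter_upwards [hsymm.continuousAt.preimage_mem_nhds hmem] with q hq
  exact coord_symmL p hq q.2

/-! ### Metric compatibility of the connection. -/

variable [IsContMDiffRiemannianBundle 𝓘(ℝ, E) ∞ E (fun x : M => TangentSpace 𝓘(ℝ, E) x)]

/-- The centre of the chart suffices, since the parallel equation at time `t` is written in the
chart at `γ t`. -/
lemma differentiableAt_metricCoeff (p : M) (v w : E) :
    DifferentiableAt ℝ (fun q : E × E × E => metricCoeff p q.1 q.2.1 q.2.2)
      (extChartAt 𝓘(ℝ, E) p p, v, w) := by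
  rw [← mdifferentiableAt_iff_differentiableAt]
  have hp (f : E × E × E → E × E) (hf : DifferentiableAt ℝ f (extChartAt 𝓘(ℝ, E) p p, v, w)) :
      MDifferentiableAt 𝓘(ℝ, E × E × E) 𝓘(ℝ, E × E) f (extChartAt 𝓘(ℝ, E) p p, v, w) :=
    mdifferentiableAt_iff_differentiableAt.2 hf
  refine MDifferentiableAt.inner_bundle (IB := 𝓘(ℝ, E)) (F := E)
    (E := fun x : M => TangentSpace 𝓘(ℝ, E) x) ?_ ?_
  · exact (mdifferentiableAt_symmL p v).comp (extChartAt 𝓘(ℝ, E) p p, v, w)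
      (hp (fun q => (q.1, q.2.1)) (by fun_prop))
  · exact (mdifferentiableAt_symmL p w).comp (extChartAt 𝓘(ℝ, E) p p, v, w)
      (hp (fun q => (q.1, q.2.2)) (by fun_prop))

/-- Derivative of the metric along a curve of coordinate data, expressed by Christoffel symbols. -/
lemma hasDerivWithinAt_metricCoeff (p : M) {c V W : ℝ → E} {c' V' W' : E} {s : Set ℝ} {t : ℝ}
    (hc : HasDerivWithinAt c c' s t) (hV : HasDerivWithinAt V V' s t)
    (hW : HasDerivWithinAt W W' s t) (hct : c t = extChartAt 𝓘(ℝ, E) p p) :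
    HasDerivWithinAt (fun r => metricCoeff p (c r) (V r) (W r))
      ((metricCoeff p (c t) V' (W t) + christoffel p (c t) c' (V t) (W t))
        + (metricCoeff p (c t) W' (V t) + christoffel p (c t) c' (W t) (V t))) s t := by
  have hF := differentiableAt_metricCoeff p (V t) (W t)
  rw [← hct] at hF
  set F := fun q : E × E × E => metricCoeff p q.1 q.2.1 q.2.2 with hFdef
  have hcomp := hF.hasFDerivAt.comp_hasDerivWithinAt_of_eq t (hc.prodMk (hV.prodMk hW)) rfl
  refine hcomp.congr_deriv ?_
  have e1 : fderiv ℝ F (c t, V t, W t) (c', 0, 0)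
      = fderiv ℝ (fun z => metricCoeff p z (V t) (W t)) (c t) c' := by
    have h : HasFDerivAt (fun z : E => (z, V t, W t))
        ((ContinuousLinearMap.id ℝ E).prod (0 : E →L[ℝ] E × E)) (c t) :=
      (hasFDerivAt_id _).prodMk (hasFDerivAt_const _ _)
    have h' := HasFDerivAt.comp (g := F) (c t) hF.hasFDerivAt h
    have h'' : (fun z => metricCoeff p z (V t) (W t)) = F ∘ fun z => (z, V t, W t) := rfl
    rw [h'', h'.fderiv]
    rfl
  -- The coefficient is affine in each vector slot, so this partial derivative is read off along a
  -- line.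
  have e2 : fderiv ℝ F (c t, V t, W t) (0, V', 0) = metricCoeff p (c t) V' (W t) := by
    have h : HasDerivAt (fun r : ℝ => (c t, V t + r • V', W t)) (0, V', 0) 0 :=
      (hasDerivAt_const _ _).prodMk
        ((by simpa using ((hasDerivAt_id (0 : ℝ)).smul_const V').const_add (V t) :
          HasDerivAt (fun r : ℝ => V t + r • V') V' 0).prodMk (hasDerivAt_const _ _))
    have h1 := hF.hasFDerivAt.comp_hasDerivAt_of_eq 0 h (by simp)
    have h2 : HasDerivAt (F ∘ fun r : ℝ => (c t, V t + r • V', W t))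
        (metricCoeff p (c t) V' (W t)) 0 := by
      have h3 : (F ∘ fun r : ℝ => (c t, V t + r • V', W t)) = fun r =>
          metricCoeff p (c t) (V t) (W t) + r * metricCoeff p (c t) V' (W t) := by
        funext r
        simp only [hFdef, Function.comp_apply, ← metricCoeff_smul_left]
        simp only [metricCoeff, map_add, inner_add_left]
      rw [h3]
      simpa using ((hasDerivAt_id (0 : ℝ)).mul_const (metricCoeff p (c t) V' (W t))).const_add
        (metricCoeff p (c t) (V t) (W t))
    exact h1.unique h2
  have e3 : fderiv ℝ F (c t, V t, W t) (0, 0, W') = metricCoeff p (c t) W' (V t) := by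
    have h : HasDerivAt (fun r : ℝ => (c t, V t, W t + r • W')) (0, 0, W') 0 :=
      (hasDerivAt_const _ _).prodMk
        ((hasDerivAt_const _ _).prodMk
          (by simpa using ((hasDerivAt_id (0 : ℝ)).smul_const W').const_add (W t)))
    have h1 := hF.hasFDerivAt.comp_hasDerivAt_of_eq 0 h (by simp)
    have h2 : HasDerivAt (F ∘ fun r : ℝ => (c t, V t, W t + r • W'))
        (metricCoeff p (c t) W' (V t)) 0 := by
      have h3 : (F ∘ fun r : ℝ => (c t, V t, W t + r • W')) = fun r =>
          metricCoeff p (c t) (V t) (W t) + r * metricCoeff p (c t) W' (V t) := by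
        funext r
        rw [metricCoeff_comm p _ W' (V t)]
        simp only [hFdef, Function.comp_apply, ← metricCoeff_smul_right]
        simp only [metricCoeff, map_add, inner_add_right]
      rw [h3]
      simpa using ((hasDerivAt_id (0 : ℝ)).mul_const (metricCoeff p (c t) W' (V t))).const_add
        (metricCoeff p (c t) (V t) (W t))
    exact h1.unique h2
  have hsum : ((c', V', W') : E × E × E) = (c', 0, 0) + (0, V', 0) + (0, 0, W') := by simp
  rw [hsum, map_add, map_add, e1, e2, e3, christoffel, christoffel]
  -- By symmetry of the metric, the mixed terms of the two Christoffel symbols cancel and the halves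
  -- add up to the derivative of `g(V, W)` along `c'`.
  have e4 : (fun z => metricCoeff p z (W t) (V t)) = fun z => metricCoeff p z (V t) (W t) :=
    funext fun z => metricCoeff_comm p z _ _
  rw [e4]
  ring

/-- In the chart at `p`, the velocity of a curve is the derivative of its coordinates. -/
lemma hasDerivWithinAt_extChartAt_comp (p : M) {γ : ℝ → M} {t : ℝ}
    (hγ : MDifferentiableWithinAt 𝓘(ℝ, ℝ) 𝓘(ℝ, E) γ (Icc 0 1) t)
    (hp : γ t ∈ (chartAt E p).source) :
    HasDerivWithinAt (fun s => extChartAt 𝓘(ℝ, E) p (γ s))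
      (coord p ⟨γ t, velocity γ t⟩) (Icc 0 1) t := by
  have h1 : MDifferentiableAt 𝓘(ℝ, E) 𝓘(ℝ, E) (extChartAt 𝓘(ℝ, E) p) (γ t) :=
    mdifferentiableAt_extChartAt (by simpa using hp)
  let D : ℝ →L[ℝ] E := (mfderiv 𝓘(ℝ, E) 𝓘(ℝ, E) (extChartAt 𝓘(ℝ, E) p) (γ t)).comp
    (mfderivWithin 𝓘(ℝ, ℝ) 𝓘(ℝ, E) γ (Icc 0 1) t)
  have h2 : HasFDerivWithinAt (extChartAt 𝓘(ℝ, E) p ∘ γ) D (Icc 0 1) t :=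
    (h1.hasMFDerivAt.comp_hasMFDerivWithinAt t hγ.hasMFDerivWithinAt).hasFDerivWithinAt
  have h3 : HasDerivWithinAt (extChartAt 𝓘(ℝ, E) p ∘ γ) (D 1) (Icc 0 1) t := h2.hasDerivWithinAt
  rw [coord_eq_continuousLinearMapAt p hp,
    TangentBundle.continuousLinearMapAt_trivializationAt (by simpa using hp)]
  exact h3

lemma eventually_mem_chart_source (p : M) {γ : ℝ → M} {s : Set ℝ} {t : ℝ}
    (hγ : ContinuousWithinAt γ s t) (hp : γ t ∈ (chartAt E p).source) :
    ∀ᶠ r in 𝓝[s] t, γ r ∈ (chartAt E p).source :=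
  hγ ((chartAt E p).open_source.mem_nhds hp)

/-- Metric compatibility of the Levi-Civita connection along a curve. -/
lemma IsParallelAlong.hasDerivWithinAt_inner {γ : ℝ → M} {V W : ∀ t, TangentSpace 𝓘(ℝ, E) (γ t)}
    (hγ : MDifferentiableOn 𝓘(ℝ, ℝ) 𝓘(ℝ, E) γ (Icc 0 1))
    (hV : IsParallelAlong γ V) (hW : IsParallelAlong γ W) {t : ℝ} (ht : t ∈ Icc (0 : ℝ) 1) :
    HasDerivWithinAt (fun s => (inner ℝ (V s) (W s) : ℝ)) 0 (Icc 0 1) t := by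
  obtain ⟨a, ha, hVa⟩ := hV t ht
  obtain ⟨b, hb, hWb⟩ := hW t ht
  have hsrc : γ t ∈ (chartAt E (γ t)).source := mem_chart_source E (γ t)
  have hc := hasDerivWithinAt_extChartAt_comp (γ t) (hγ t ht) hsrc
  have h := hasDerivWithinAt_metricCoeff (γ t) hc ha hb rfl
  rw [hVa, hWb, add_zero] at h
  refine h.congr_of_eventuallyEq ?_ (inner_eq_metricCoeff (γ t) hsrc _ _)
  filter_upwards [eventually_mem_chart_source (γ t) (hγ t ht).continuousWithinAt hsrc] with s hs
  exact inner_eq_metricCoeff (γ t) hs _ _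

lemma IsParallelAlong.inner_eq {γ : ℝ → M} {V W : ∀ t, TangentSpace 𝓘(ℝ, E) (γ t)}
    (hγ : MDifferentiableOn 𝓘(ℝ, ℝ) 𝓘(ℝ, E) γ (Icc 0 1))
    (hV : IsParallelAlong γ V) (hW : IsParallelAlong γ W) {t : ℝ} (ht : t ∈ Icc (0 : ℝ) 1) :
    (inner ℝ (V t) (W t) : ℝ) = inner ℝ (V 0) (W 0) := by
  have h (s) (hs : s ∈ Icc (0 : ℝ) 1) := hV.hasDerivWithinAt_inner hγ hW hs
  refine constant_of_derivWithin_zero (fun s hs => (h s hs).differentiableWithinAt) ?_ t ht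
  intro s hs
  exact (h s ⟨hs.1, hs.2.le⟩).derivWithin (uniqueDiffOn_Icc zero_lt_one s ⟨hs.1, hs.2.le⟩)

/-! ### Speed, regularity and initial segments of geodesics. -/

lemma IsGeodesic.norm_velocity_eq {γ : ℝ → M} (hγ : IsGeodesic E γ) {t : ℝ}
    (ht : t ∈ Icc (0 : ℝ) 1) : ‖velocity (E := E) γ t‖ = ‖velocity (E := E) γ 0‖ := by
  have h := hγ.2.inner_eq hγ.1 hγ.2 ht
  rw [real_inner_self_eq_norm_sq, real_inner_self_eq_norm_sq] at h
  exact (pow_left_inj₀ (norm_nonneg _) (norm_nonneg _) two_ne_zero).1 h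

/-- The speed is constant, so the length over `[0, 1]` equals it; minimality equates the length with
the distance. -/
lemma IsMinGeodesicIn.enorm_velocity {X : Set M} {γ : ℝ → M} {x y : M}
    (h : IsMinGeodesicIn E X γ x y) {t : ℝ} (ht : t ∈ Icc (0 : ℝ) 1) :
    ‖velocity (E := E) γ t‖ₑ = edist x y := by
  have h1 := h.minimizing
  rw [Manifold.pathELength_eq_lintegral_mfderivWithin_Icc] at h1
  have h2 : ∫⁻ s in Icc (0 : ℝ) 1, ‖velocity (E := E) γ s‖ₑ = ‖velocity (E := E) γ t‖ₑ := by
    rw [setLIntegral_congr_fun (g := fun _ => ‖velocity (E := E) γ t‖ₑ) measurableSet_Icc]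
    · simp
    · intro s hs
      simp only [← ofReal_norm, IsGeodesic.norm_velocity_eq h.geodesic hs,
        IsGeodesic.norm_velocity_eq h.geodesic ht]
  exact h2.symm.trans h1

/-- The speed of a minimizing geodesic is the distance of its endpoints. -/
lemma IsMinGeodesicIn.norm_velocity {X : Set M} {γ : ℝ → M} {x y : M}
    (h : IsMinGeodesicIn E X γ x y) {t : ℝ} (ht : t ∈ Icc (0 : ℝ) 1) :
    ‖velocity (E := E) γ t‖ = (edist x y).toReal := by
  rw [← h.enorm_velocity ht, toReal_enorm]

/-- `M` need not be connected, so finiteness has to come from the geodesic. -/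
lemma IsMinGeodesicIn.edist_ne_top {X : Set M} {γ : ℝ → M} {x y : M}
    (h : IsMinGeodesicIn E X γ x y) : edist x y ≠ ⊤ := by
  rw [← h.enorm_velocity ⟨le_rfl, zero_le_one⟩]
  exact enorm_ne_top

/-- A parallel velocity is differentiable in charts, hence continuous, so mere differentiability of
`γ` upgrades to `C¹`. The Riemannian distance is compared with lengths of `C¹` paths. -/
lemma IsGeodesic.contMDiffOn {γ : ℝ → M} (hγ : IsGeodesic E γ) :
    ContMDiffOn 𝓘(ℝ, ℝ) 𝓘(ℝ, E) 1 γ (Icc 0 1) := by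
  have hcont (p : M) (s) (hs : s ∈ Icc (0 : ℝ) 1) (hp : γ s ∈ (chartAt E p).source) :
      ContinuousWithinAt (fun s => coord p ⟨γ s, velocity (E := E) γ s⟩) (Icc 0 1) s := by
    have h1 : ContinuousWithinAt
        (fun s => (⟨γ s, velocity γ s⟩ : TangentBundle 𝓘(ℝ, E) M)) (Icc 0 1) s := by
      rw [FiberBundle.continuousWithinAt_totalSpace]
      refine ⟨(hγ.1 s hs).continuousWithinAt, ?_⟩
      obtain ⟨a, ha, -⟩ := hγ.2 s hs
      exact ha.continuousWithinAt
    have h2 : ContinuousAt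
        (trivializationAt E (fun x : M => TangentSpace 𝓘(ℝ, E) x) p)
        (⟨γ s, velocity γ s⟩ : TangentBundle 𝓘(ℝ, E) M) :=
      (trivializationAt E (fun x : M => TangentSpace 𝓘(ℝ, E) x) p).continuousAt
        (by simpa using hp)
    exact continuous_snd.continuousAt.comp_continuousWithinAt (ContinuousAt.comp_continuousWithinAt
      (f := fun s => (⟨γ s, velocity γ s⟩ : TangentBundle 𝓘(ℝ, E) M)) h2 h1)
  intro t ht
  have hsrc : γ t ∈ (chartAt E (γ t)).source := mem_chart_source E (γ t)
  rw [contMDiffWithinAt_iff_target]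
  refine ⟨(hγ.1 t ht).continuousWithinAt, ContDiffWithinAt.contMDiffWithinAt ?_⟩
  have hu : {s | γ s ∈ (chartAt E (γ t)).source} ∩ Icc 0 1 ∈ 𝓝[Icc 0 1] t :=
    inter_mem (eventually_mem_chart_source (γ t) (hγ.1 t ht).continuousWithinAt hsrc)
      self_mem_nhdsWithin
  rw [show (1 : ℕ∞ω) = 0 + 1 from (zero_add 1).symm,
    contDiffWithinAt_succ_iff_hasFDerivWithinAt (by simp)]
  rw [insert_eq_of_mem ht]
  refine ⟨_, hu, by simp, fun s => ContinuousLinearMap.toSpanSingleton ℝ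
    (coord (γ t) ⟨γ s, velocity γ s⟩), ?_, ?_⟩
  · intro s hs
    exact ((hasDerivWithinAt_extChartAt_comp (γ t) (hγ.1 s hs.2) hs.1).mono
      inter_subset_right).hasFDerivWithinAt
  · have htu : t ∈ {s | γ s ∈ (chartAt E (γ t)).source} ∩ Icc (0 : ℝ) 1 := ⟨hsrc, ht⟩
    rw [contDiffWithinAt_zero htu]
    refine ⟨_, self_mem_nhdsWithin, ?_⟩
    rw [inter_self]
    intro s hs
    exact (ContinuousLinearMap.toSpanSingletonCLE.continuous.continuousAt.comp_continuousWithinAt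
      ((hcont (γ t) s hs.2 hs.1).mono inter_subset_right))

lemma mul_mem_Icc {c s : ℝ} (hc : c ∈ Icc (0 : ℝ) 1) (hs : s ∈ Icc (0 : ℝ) 1) :
    c * s ∈ Icc (0 : ℝ) 1 :=
  ⟨mul_nonneg hc.1 hs.1, mul_le_one₀ hc.2 hs.1 hs.2⟩

lemma hasMFDerivWithinAt_comp_mul {γ : ℝ → M} {c s : ℝ} (hc : c ∈ Icc (0 : ℝ) 1)
    (hγ : MDifferentiableWithinAt 𝓘(ℝ, ℝ) 𝓘(ℝ, E) γ (Icc 0 1) (c * s)) :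
    HasMFDerivWithinAt 𝓘(ℝ, ℝ) 𝓘(ℝ, E) (fun s => γ (c * s)) (Icc 0 1) s
      ((mfderivWithin 𝓘(ℝ, ℝ) 𝓘(ℝ, E) γ (Icc 0 1) (c * s)).comp
        (c • ContinuousLinearMap.id ℝ ℝ)) := by
  have h1 : HasFDerivWithinAt (fun s : ℝ => c * s) (c • ContinuousLinearMap.id ℝ ℝ) (Icc 0 1) s :=
    (hasFDerivWithinAt_id s _).const_mul c
  exact hγ.hasMFDerivWithinAt.comp s h1.hasMFDerivWithinAt (fun r hr => mul_mem_Icc hc hr)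

lemma velocity_comp_mul {γ : ℝ → M} {c s : ℝ} (hc : c ∈ Icc (0 : ℝ) 1)
    (hs : s ∈ Icc (0 : ℝ) 1)
    (hγ : MDifferentiableWithinAt 𝓘(ℝ, ℝ) 𝓘(ℝ, E) γ (Icc 0 1) (c * s)) :
    velocity (E := E) (fun s => γ (c * s)) s = c • velocity (E := E) γ (c * s) := by
  have h := (hasMFDerivWithinAt_comp_mul hc hγ).mfderivWithin
    (uniqueMDiffWithinAt_iff_uniqueDiffWithinAt.2 (uniqueDiffOn_Icc zero_lt_one s hs))
  rw [velocity, h]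
  change mfderivWithin 𝓘(ℝ, ℝ) 𝓘(ℝ, E) γ (Icc 0 1) (c * s) (c • (1 : ℝ)) = _
  exact map_smul _ c (1 : ℝ)

lemma IsGeodesic.comp_mul {γ : ℝ → M} (hγ : IsGeodesic E γ) {c : ℝ} (hc : c ∈ Icc (0 : ℝ) 1) :
    IsGeodesic E (fun s => γ (c * s)) := by
  refine ⟨fun _ hs => (hasMFDerivWithinAt_comp_mul hc
    (hγ.1 _ (mul_mem_Icc hc hs))).mdifferentiableWithinAt, fun t ht => ?_⟩
  obtain ⟨a, ha, hw⟩ := hγ.2 (c * t) (mul_mem_Icc hc ht)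
  have hvel (s) (hs : s ∈ Icc (0 : ℝ) 1) : coord (γ (c * t))
      ⟨γ (c * s), velocity (E := E) (fun s => γ (c * s)) s⟩
      = c • coord (γ (c * t)) ⟨γ (c * s), velocity (E := E) γ (c * s)⟩ := by
    rw [velocity_comp_mul hc hs (hγ.1 _ (mul_mem_Icc hc hs)), coord_smul]
  -- One factor `c` comes from the slowed velocity, the other from the chain rule.
  refine ⟨c • c • a, ?_, fun w => ?_⟩
  · have h1 : HasDerivWithinAt (fun s : ℝ => c * s) c (Icc 0 1) t := by
      simpa using (hasDerivWithinAt_id t _).const_mul c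
    exact ((ha.scomp t h1 (fun r hr => mul_mem_Icc hc hr)).const_smul c).congr hvel (hvel t ht)
  · rw [hvel t ht, christoffel_smul_smul, metricCoeff_smul_left, metricCoeff_smul_left]
    linear_combination c ^ 2 * hw w

lemma IsGeodesic.edist_le_pathELength [IsRiemannianManifold 𝓘(ℝ, E) M] {γ : ℝ → M}
    (hγ : IsGeodesic E γ) {s t : ℝ} (hs : 0 ≤ s) (hst : s ≤ t) (ht : t ≤ 1) :
    edist (γ s) (γ t) ≤ Manifold.pathELength 𝓘(ℝ, E) γ s t := by
  rw [IsRiemannianManifold.out (I := 𝓘(ℝ, E)) (γ s) (γ t)]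
  exact Manifold.riemannianEDist_le_pathELength
    (hγ.contMDiffOn.mono (Icc_subset_Icc hs ht)) rfl rfl hst

/-- An initial segment of a minimizing geodesic is a minimizing geodesic. -/
lemma IsMinGeodesicIn.comp_mul [IsRiemannianManifold 𝓘(ℝ, E) M] {X : Set M} {γ : ℝ → M} {x y : M}
    (h : IsMinGeodesicIn E X γ x y) {c : ℝ} (hc : c ∈ Icc (0 : ℝ) 1) :
    IsMinGeodesicIn E X (fun s => γ (c * s)) x (γ c) where
  source := by simp [h.source]
  target := by simp
  geodesic := IsGeodesic.comp_mul h.geodesic hc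
  mem t ht := h.mem _ (mul_mem_Icc hc ht)
  minimizing := by
    have hlen : Manifold.pathELength 𝓘(ℝ, E) (fun s => γ (c * s)) 0 1
        = Manifold.pathELength 𝓘(ℝ, E) γ 0 c := by
      have := Manifold.pathELength_comp_of_monotoneOn (I := 𝓘(ℝ, E)) (γ := γ)
        (f := fun s : ℝ => c * s) zero_le_one
        (fun _ _ _ _ hab => mul_le_mul_of_nonneg_left hab hc.1) (by fun_prop)
        (h.geodesic.1.mono (by simpa using Icc_subset_Icc_right hc.2))
      simpa [Function.comp_def] using this
    rw [hlen]
    have h1 := IsGeodesic.edist_le_pathELength h.geodesic le_rfl hc.1 hc.2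
    have h2 := IsGeodesic.edist_le_pathELength h.geodesic hc.1 hc.2 le_rfl
    rw [h.source] at h1
    rw [h.target] at h2
    have h3 := Manifold.pathELength_add (I := 𝓘(ℝ, E)) (γ := γ) hc.1 hc.2
    rw [h.minimizing] at h3
    refine le_antisymm ?_ h1
    -- The triangle inequality bounds both pieces together by the distances of their endpoints;
    -- cancelling the tail requires its length to be finite.
    have hfin : Manifold.pathELength 𝓘(ℝ, E) γ c 1 ≠ ⊤ :=
      ne_top_of_le_ne_top h.edist_ne_top (h3 ▸ le_add_self)
    refine (ENNReal.add_le_add_iff_right hfin).1 ?_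
    calc _ = edist x y := h3
      _ ≤ edist x (γ c) + edist (γ c) y := edist_triangle _ _ _
      _ ≤ _ := by gcongr

/-! ### The inverse exponential map and descent along geodesics. -/

/-- The equality lives in the tangent bundle because the two velocities have different fibre types.
-/
lemma velocity_congr {γ γ' : ℝ → M} (h : EqOn γ' γ (Icc 0 1)) {t : ℝ} (ht : t ∈ Icc (0 : ℝ) 1) :
    (⟨γ' t, velocity γ' t⟩ : TangentBundle 𝓘(ℝ, E) M) = ⟨γ t, velocity γ t⟩ := by
  have h1 : mfderivWithin 𝓘(ℝ, ℝ) 𝓘(ℝ, E) γ' (Icc 0 1) t =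
      mfderivWithin 𝓘(ℝ, ℝ) 𝓘(ℝ, E) γ (Icc 0 1) t := mfderivWithin_congr h (h ht)
  have h2 (a b : M) (hab : a = b) (u v : E) (huv : u = v) :
      (⟨a, u⟩ : TangentBundle 𝓘(ℝ, E) M) = ⟨b, v⟩ := by rw [hab, huv]
  exact h2 _ _ (h ht) _ _ (congrArg (fun D : ℝ →L[ℝ] E => D 1) h1)

/-- The inverse exponential map is the initial velocity of the minimizing geodesic. -/
lemma IsMinGeodesicIn.expInv_eq {X : Set M} (hX : IsGeodesicallyConvex E X) {γ : ℝ → M} {y : M}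
    (h : IsMinGeodesicIn E X γ (γ 0) y) : expInv X (γ 0) y = velocity (E := E) γ 0 := by
  have h0 : (0 : ℝ) ∈ Icc (0 : ℝ) 1 := ⟨le_rfl, zero_le_one⟩
  have hy : y ∈ X := h.target ▸ h.mem 1 ⟨zero_le_one, le_rfl⟩
  have hex : ∃ v : TangentSpace 𝓘(ℝ, E) (γ 0), IsExpInv X (γ 0) y v := ⟨_, γ, h, rfl⟩
  rw [expInv, dif_pos hex]
  obtain ⟨γ', h', hv⟩ := hex.choose_spec
  obtain ⟨γ₀, -, huniq⟩ := hX (γ 0) (h.mem 0 h0) y hy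
  rw [velocity_congr (huniq γ' h') h0, ← velocity_congr (huniq γ h) h0] at hv
  exact (TotalSpace.mk_inj.1 hv).symm

lemma norm_expInv {X : Set M} (hX : IsGeodesicallyConvex E X) {x y : M} (hx : x ∈ X) (hy : y ∈ X) :
    ‖expInv (E := E) X x y‖ = (edist x y).toReal := by
  obtain ⟨γ, h, -⟩ := hX x hx y hy
  obtain rfl := h.source
  rw [h.expInv_eq hX, h.norm_velocity ⟨le_rfl, zero_le_one⟩]

lemma inner_grad {f : M → ℝ} {x : M} (v : TangentSpace 𝓘(ℝ, E) x) :
    inner ℝ (grad f x) v = mfderiv 𝓘(ℝ, E) 𝓘(ℝ, ℝ) f x v :=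
  InnerProductSpace.toDual_symm_apply

lemma hasDerivWithinAt_comp_curve {f : M → ℝ} {γ : ℝ → M} {t : ℝ}
    (hγ : MDifferentiableWithinAt 𝓘(ℝ, ℝ) 𝓘(ℝ, E) γ (Icc 0 1) t)
    (hf : MDifferentiableAt 𝓘(ℝ, E) 𝓘(ℝ, ℝ) f (γ t)) :
    HasDerivWithinAt (fun s => f (γ s)) (inner ℝ (grad f (γ t)) (velocity (E := E) γ t))
      (Icc 0 1) t := by
  let D : ℝ →L[ℝ] ℝ := (mfderiv 𝓘(ℝ, E) 𝓘(ℝ, ℝ) f (γ t)).comp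
    (mfderivWithin 𝓘(ℝ, ℝ) 𝓘(ℝ, E) γ (Icc 0 1) t)
  have h2 : HasFDerivWithinAt (f ∘ γ) D (Icc 0 1) t :=
    (hf.hasMFDerivAt.comp_hasMFDerivWithinAt t hγ.hasMFDerivWithinAt).hasFDerivWithinAt
  have h3 : HasDerivWithinAt (f ∘ γ) (D 1) (Icc 0 1) t := h2.hasDerivWithinAt
  rw [inner_grad]
  exact h3

/-- Along a geodesic, the derivative of an `L`-smooth function is `L`-Lipschitz at the origin. -/
lemma IsLSmoothOn.inner_grad_velocity_le [IsRiemannianManifold 𝓘(ℝ, E) M] {X : Set M}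
    (hX : IsGeodesicallyConvex E X) {f : M → ℝ} {L : ℝ} (hf : IsLSmoothOn E X f L)
    {γ : ℝ → M} {x y : M} (h : IsMinGeodesicIn E X γ x y) {t : ℝ} (ht : t ∈ Icc (0 : ℝ) 1) :
    inner ℝ (grad f (γ t)) (velocity (E := E) γ t)
      ≤ inner ℝ (grad f (γ 0)) (velocity (E := E) γ 0) + L * (edist x y).toReal ^ 2 * t := by
  have h0 : (0 : ℝ) ∈ Icc (0 : ℝ) 1 := ⟨le_rfl, zero_le_one⟩
  have h1 : (1 : ℝ) ∈ Icc (0 : ℝ) 1 := ⟨zero_le_one, le_rfl⟩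
  rcases ht.1.eq_or_lt with rfl | htpos
  · simp
  have hxX : x ∈ X := h.source ▸ h.mem 0 h0
  obtain ⟨γ', V, h', hV, hV0, hle⟩ := hf.2 x hxX (γ t) (h.mem t ht)
  have hc := h.comp_mul ht
  obtain ⟨γ₀, -, huniq⟩ := hX x hxX (γ t) (h.mem t ht)
  -- Uniqueness identifies the geodesic supplied by smoothness with the initial segment of `γ`, so
  -- its velocity is `t` times that of `γ`.
  have heq : EqOn γ' (fun s => γ (t * s)) (Icc 0 1) := fun s hs => by
    rw [huniq γ' h' hs, ← huniq _ hc hs]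
  let F : TangentBundle 𝓘(ℝ, E) M → ℝ := fun v => inner ℝ (grad f v.1) v.2
  have hF (s : ℝ) (hs : s ∈ Icc (0 : ℝ) 1) : inner ℝ (grad f (γ' s)) (velocity (E := E) γ' s)
      = t * inner ℝ (grad f (γ (t * s))) (velocity (E := E) γ (t * s)) := by
    have := congrArg F (velocity_congr heq hs)
    refine this.trans ?_
    simp only [F]
    rw [velocity_comp_mul ht hs (h.geodesic.1 _ (mul_mem_Icc ht hs)), real_inner_smul_right]
  have hF0 := hF 0 h0
  have hF1 := hF 1 h1
  rw [mul_zero] at hF0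
  rw [mul_one] at hF1
  have hpar := hV.inner_eq h'.geodesic.1 h'.geodesic.2 h1
  rw [hV0, hF0] at hpar
  have hdist : (edist x (γ t)).toReal = t * (edist x y).toReal := by
    rw [← hc.norm_velocity h0, velocity_comp_mul ht h0 (h.geodesic.1 _ (mul_mem_Icc ht h0)),
      norm_smul, h.norm_velocity (mul_mem_Icc ht h0), Real.norm_of_nonneg ht.1]
  -- Since `V` and the velocity are parallel, Cauchy-Schwarz bounds `t` times the change of
  -- derivative by `L (t d)²`, with `d` the distance from `x` to `y`; one factor `t` then cancels.
  have hcs := real_inner_le_norm (grad f (γ' 1) - V 1) (velocity (E := E) γ' 1)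
  rw [inner_sub_left, hF1, hpar, h'.norm_velocity h1] at hcs
  have hmul := mul_le_mul_of_nonneg_right hle (ENNReal.toReal_nonneg (a := edist x (γ t)))
  rw [hdist] at hcs hmul
  refine le_of_mul_le_mul_left ?_ htpos
  linarith

/-- The quadratic upper bound for an `L`-smooth function along a minimizing geodesic. -/
lemma IsLSmoothOn.apply_le [IsRiemannianManifold 𝓘(ℝ, E) M] {X : Set M}
    (hX : IsGeodesicallyConvex E X) {f : M → ℝ} {L : ℝ} (hf : IsLSmoothOn E X f L)
    {γ : ℝ → M} {x y : M} (h : IsMinGeodesicIn E X γ x y) {t : ℝ} (ht : t ∈ Icc (0 : ℝ) 1) :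
    f (γ t) ≤ f x + t * inner ℝ (grad f x) (expInv (E := E) X x y)
      + L * (edist x y).toReal ^ 2 * t ^ 2 / 2 := by
  obtain rfl := h.source
  rw [h.expInv_eq hX]
  set a : ℝ := inner ℝ (grad f (γ 0)) (velocity (E := E) γ 0) with ha
  set b : ℝ := L * (edist (γ 0) y).toReal ^ 2 with hb
  -- The difference between `f ∘ γ` and its quadratic model has nonpositive derivative, so its value
  -- at `t` is at most its value at `0`.
  have hderiv (s) (hs : s ∈ Icc (0 : ℝ) 1) :
      HasDerivWithinAt (fun s => f (γ s) - (s * a + b * s ^ 2 / 2))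
        (inner ℝ (grad f (γ s)) (velocity (E := E) γ s) - (a + b * s)) (Icc 0 1) s := by
    have h1 := hasDerivWithinAt_comp_curve (h.geodesic.1 s hs) (hf.1 _ (h.mem s hs))
    have h2 : HasDerivAt (fun s : ℝ => s * a + b * s ^ 2 / 2) (a + b * s) s := by
      have := ((hasDerivAt_id s).mul_const a).add ((((hasDerivAt_id s).pow 2).const_mul b).div_const 2)
      refine this.congr_deriv ?_
      simp
      ring
    exact h1.sub h2.hasDerivWithinAt
  have hanti : AntitoneOn (fun s => f (γ s) - (s * a + b * s ^ 2 / 2)) (Icc 0 1) := by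
    refine antitoneOn_of_hasDerivWithinAt_nonpos (convex_Icc 0 1)
      (fun s hs => (hderiv s hs).continuousWithinAt)
      (fun s hs => (hderiv s (interior_subset hs)).mono interior_subset) (fun s hs => ?_)
    have := hf.inner_grad_velocity_le hX h (interior_subset hs)
    linarith
  have := hanti ⟨le_rfl, zero_le_one⟩ ht ht.1
  simp only [zero_mul, ne_eq, OfNat.ofNat_ne_zero, not_false_eq_true, zero_pow, mul_zero,
    zero_div, add_zero, sub_zero] at this
  linarith

end Geometry

/-! ### One Frank-Wolfe step. -/

section FrankWolfeStep

variable {E : Type*} [NormedAddCommGroup E] [NormedSpace ℝ E] [FiniteDimensional ℝ E]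
  {M : Type*} [EMetricSpace M] [ChartedSpace E M] [IsManifold 𝓘(ℝ, E) ∞ M]
  [RiemannianBundle (fun x : M => TangentSpace 𝓘(ℝ, E) x)]

variable [IsContMDiffRiemannianBundle 𝓘(ℝ, E) ∞ E (fun x : M => TangentSpace 𝓘(ℝ, E) x)]

lemma inner_expInv_le {X : Set M} (hX : IsGeodesicallyConvex E X) {D : ℝ}
    (hD : ∀ x ∈ X, ∀ y ∈ X, (edist x y).toReal ≤ D) {x y : M} (hx : x ∈ X) (hy : y ∈ X)
    (v : TangentSpace 𝓘(ℝ, E) x) : inner ℝ (expInv X x y) v ≤ D * ‖v‖ := by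
  refine (real_inner_le_norm _ _).trans ?_
  rw [norm_expInv hX hx hy]
  exact mul_le_mul_of_nonneg_right (hD x hx y hy) (norm_nonneg v)

lemma fwGap_nonneg {X : Set M} (hX : IsGeodesicallyConvex E X) {D : ℝ}
    (hD : ∀ x ∈ X, ∀ y ∈ X, (edist x y).toReal ≤ D) (f : M → ℝ) {x : M} (hx : x ∈ X) :
    0 ≤ fwGap E X f x := by
  have h0 : expInv (E := E) X x x = 0 := by
    rw [← norm_eq_zero, norm_expInv hX hx hx, edist_self, ENNReal.toReal_zero]
  have h := le_ciSup (f := fun y : X => (inner ℝ (expInv (E := E) X x y) (-grad f x) : ℝ))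
    ⟨D * ‖-grad (E := E) f x‖, by
      rintro _ ⟨y, rfl⟩; exact inner_expInv_le hX hD hx y.2 _⟩ ⟨x, hx⟩
  simp only [h0, inner_zero_left] at h
  exact h

/-- An answer of the linear oracle to an approximate gradient controls the Frank-Wolfe gap. -/
lemma fwGap_le_of_isRLOAnswer {X : Set M} (hX : IsGeodesicallyConvex E X) {D : ℝ}
    (hD : ∀ x ∈ X, ∀ y ∈ X, (edist x y).toReal ≤ D) (f : M → ℝ) {x y : M} (hx : x ∈ X)
    {g : TangentSpace 𝓘(ℝ, E) x} (hy : IsRLOAnswer X x g y) :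
    fwGap E X f x ≤ -inner ℝ (grad (E := E) f x) (expInv X x y) + 2 * D * ‖grad f x - g‖ := by
  have : Nonempty X := ⟨⟨x, hx⟩⟩
  refine ciSup_le fun z => ?_
  have h1 := hy.2 z z.2
  -- The gradient error is paired once with the competitor `z` and once with the answer `y`; hence
  -- the factor `2 * D`.
  have h2 := inner_expInv_le hX hD hx z.2 (-(grad f x - g))
  have h3 := inner_expInv_le hX hD hx hy.1 (grad f x - g)
  rw [norm_neg, inner_neg_right, inner_sub_right] at h2
  rw [inner_sub_right] at h3
  rw [inner_neg_right]
  simp only [real_inner_comm] at *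
  linarith

/-- The progress of one Frank-Wolfe step. -/
lemma fwGap_le_of_step [IsRiemannianManifold 𝓘(ℝ, E) M] {X : Set M}
    (hX : IsGeodesicallyConvex E X) {D : ℝ}
    (hD : ∀ x ∈ X, ∀ y ∈ X, (edist x y).toReal ≤ D) {f : M → ℝ} {L : ℝ}
    (hf : IsLSmoothOn E X f L) {x y : M} (hx : x ∈ X)
    {g : TangentSpace 𝓘(ℝ, E) x} (hy : IsRLOAnswer X x g y) {γ : ℝ → M}
    (h : IsMinGeodesicIn E X γ x y) {η : ℝ} (hη : 0 < η) (hη1 : η ≤ 1) :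
    fwGap E X f x ≤ (f x - f (γ η)) / η + |L| * D ^ 2 * η / 2 + 2 * D * ‖grad f x - g‖ := by
  have h1 := hf.apply_le hX h ⟨hη.le, hη1⟩
  have h2 := fwGap_le_of_isRLOAnswer hX hD f hx hy
  have h3 : L * (edist x y).toReal ^ 2 ≤ |L| * D ^ 2 := by
    have h4 := pow_le_pow_left₀ ENNReal.toReal_nonneg (hD x hx y hy.1) 2
    calc L * (edist x y).toReal ^ 2 ≤ |L| * (edist x y).toReal ^ 2 := by
          gcongr; exact le_abs_self L
      _ ≤ |L| * D ^ 2 := by gcongr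
  have h5 : -inner ℝ (grad f x) (expInv (E := E) X x y)
      ≤ (f x - f (γ η)) / η + |L| * D ^ 2 * η / 2 := by
    rw [← sub_le_iff_le_add, le_div_iff₀ hη]
    have := mul_le_mul_of_nonneg_right h3 (sq_nonneg η)
    linarith
  linarith

/-- By compactness the extended distance attains its maximum on pairs; a minimizing geodesic between
such a pair shows that it is finite. -/
lemma exists_edist_le {X : Set M} (hXc : IsCompact X) (hX : IsGeodesicallyConvex E X) :
    ∃ D : ℝ, 0 ≤ D ∧ ∀ x ∈ X, ∀ y ∈ X, (edist x y).toReal ≤ D := by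
  rcases X.eq_empty_or_nonempty with rfl | hne
  · exact ⟨0, le_rfl, by simp⟩
  obtain ⟨q, hq, hmax⟩ := (hXc.prod hXc).exists_isMaxOn (hne.prod hne)
    (f := fun q : M × M => edist q.1 q.2) (by fun_prop)
  obtain ⟨γ, h, -⟩ := hX q.1 hq.1 q.2 hq.2
  exact ⟨_, ENNReal.toReal_nonneg, fun x hx y hy =>
    ENNReal.toReal_mono h.edist_ne_top (hmax (mk_mem_prod hx hy))⟩

end FrankWolfeStep

/-! ### Mean error of a minibatch. -/

section Batch

/-- One coordinate at a time, this is additivity of scalar variances under a product measure: `b`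
equal variances divided by `b²`. Summing over an orthonormal basis recovers the squared norm. -/
lemma integral_sq_inner_batch_le {Ξ : Type*} [MeasurableSpace Ξ] {P : Measure Ξ}
    [IsProbabilityMeasure P] {H : Type*} [NormedAddCommGroup H] [InnerProductSpace ℝ H]
    [CompleteSpace H] {Z : Ξ → H} (hZ : AEStronglyMeasurable Z P) {C : ℝ}
    (hC : ∀ᵐ ξ ∂P, ‖Z ξ‖ ≤ C) {b : ℕ} (hb : 0 < b) (e : H) :
    Integrable (fun ξ : Fin b → Ξ => inner ℝ e (∫ ζ, Z ζ ∂P - (b : ℝ)⁻¹ • ∑ i, Z (ξ i)) ^ 2)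
        (Measure.pi fun _ => P) ∧
      ∫ ξ : Fin b → Ξ, inner ℝ e (∫ ζ, Z ζ ∂P - (b : ℝ)⁻¹ • ∑ i, Z (ξ i)) ^ 2
        ∂(Measure.pi fun _ => P) ≤ (b : ℝ)⁻¹ * ∫ ζ, inner ℝ e (Z ζ) ^ 2 ∂P := by
  have hb0 : (b : ℝ) ≠ 0 := by positivity
  have hZ2 : MemLp Z 2 P := MemLp.of_bound hZ C hC
  have hX : MemLp (fun ζ => (inner ℝ e (Z ζ) : ℝ)) 2 P := hZ2.const_inner e
  have hS : MemLp (∑ i, fun ξ : Fin b → Ξ => (inner ℝ e (Z (ξ i)) : ℝ)) 2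
      (Measure.pi fun _ => P) :=
    memLp_finsetSum' _ fun i _ => hX.comp_measurePreserving (measurePreserving_eval _ i)
  have hvar := variance_sum_pi (ι := Fin b) (μ := fun _ => P) (X := fun _ ζ => (inner ℝ e (Z ζ) : ℝ))
    fun _ => hX
  have hmean : ∫ ξ, (∑ i, fun ξ : Fin b → Ξ => (inner ℝ e (Z (ξ i)) : ℝ)) ξ
      ∂(Measure.pi fun _ => P) = b * inner ℝ e (∫ ζ, Z ζ ∂P) := by
    simp only [Finset.sum_apply]
    rw [integral_finsetSum]
    · have h (i : Fin b) : ∫ ξ : Fin b → Ξ, (inner ℝ e (Z (ξ i)) : ℝ) ∂(Measure.pi fun _ => P)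
          = inner ℝ e (∫ ζ, Z ζ ∂P) := by
        rw [integral_comp_eval (μ := fun _ => P) (f := fun ζ => (inner ℝ e (Z ζ) : ℝ))
          hX.aestronglyMeasurable]
        exact integral_inner (hZ2.integrable one_le_two) e
      simp [h]
    · exact fun i _ => (hX.comp_measurePreserving
        (measurePreserving_eval (fun _ => P) i)).integrable one_le_two
  rw [variance_eq_integral hS.aestronglyMeasurable.aemeasurable, hmean] at hvar
  have hpt (ξ : Fin b → Ξ) : (inner ℝ e (∫ ζ, Z ζ ∂P - (b : ℝ)⁻¹ • ∑ i, Z (ξ i)) : ℝ) ^ 2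
      = ((b : ℝ) ^ 2)⁻¹ * ((∑ i, fun ξ : Fin b → Ξ => (inner ℝ e (Z (ξ i)) : ℝ)) ξ
        - b * inner ℝ e (∫ ζ, Z ζ ∂P)) ^ 2 := by
    rw [inner_sub_right, real_inner_smul_right, inner_sum, Finset.sum_apply]
    field_simp
    ring
  simp only [hpt]
  refine ⟨((hS.sub (memLp_const _)).integrable_sq).const_mul _, ?_⟩
  rw [integral_const_mul, hvar]
  have hle := variance_le_expectation_sq (μ := P) hX.aestronglyMeasurable
  simp only [Finset.sum_const, Finset.card_univ, Fintype.card_fin, nsmul_eq_mul]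
  calc _ = (b : ℝ)⁻¹ * Var[fun ζ => (inner ℝ e (Z ζ) : ℝ); P] := by field_simp
    _ ≤ _ := by gcongr; exact hle

/-- The mean of `b` independent bounded vectors is within `O(1 / √b)` of its expectation. -/
lemma lintegral_norm_batch_le {Ξ : Type*} [MeasurableSpace Ξ] {P : Measure Ξ}
    [IsProbabilityMeasure P] {H : Type*} [NormedAddCommGroup H] [InnerProductSpace ℝ H]
    [FiniteDimensional ℝ H] {Z : Ξ → H} (hZ : AEStronglyMeasurable Z P) {C : ℝ}
    (hC : ∀ᵐ ξ ∂P, ‖Z ξ‖ ≤ C) {b : ℕ} (hb : 0 < b) :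
    ∫⁻ ξ : Fin b → Ξ, ENNReal.ofReal ‖∫ ζ, Z ζ ∂P - (b : ℝ)⁻¹ • ∑ i, Z (ξ i)‖
      ∂(Measure.pi fun _ => P) ≤ ENNReal.ofReal ((C ^ 2 + 1) / (2 * √b)) := by
  have : CompleteSpace H := FiniteDimensional.complete ℝ H
  have hb0 : 0 < √(b : ℝ) := by positivity
  set B := stdOrthonormalBasis ℝ H
  set err : (Fin b → Ξ) → H := fun ξ => ∫ ζ, Z ζ ∂P - (b : ℝ)⁻¹ • ∑ i, Z (ξ i)
  have hj j := integral_sq_inner_batch_le hZ hC hb (B j)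
  have hZ2 : MemLp Z 2 P := MemLp.of_bound hZ C hC
  have hsum (v : H) : ‖v‖ ^ 2 = ∑ j, (inner ℝ (B j) v : ℝ) ^ 2 := (B.sum_sq_inner_right v).symm
  have hint : Integrable (fun ξ => ‖err ξ‖ ^ 2) (Measure.pi fun _ => P) := by
    simp only [hsum]
    exact integrable_finsetSum _ fun j _ => (hj j).1
  have hle : ∫ ξ, ‖err ξ‖ ^ 2 ∂(Measure.pi fun _ => P) ≤ (b : ℝ)⁻¹ * C ^ 2 := by
    calc ∫ ξ, ‖err ξ‖ ^ 2 ∂(Measure.pi fun _ => P)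
        = ∑ j, ∫ ξ, (inner ℝ (B j) (err ξ) : ℝ) ^ 2 ∂(Measure.pi fun _ => P) := by
          simp only [hsum]
          exact integral_finsetSum _ fun j _ => (hj j).1
      _ ≤ ∑ j, (b : ℝ)⁻¹ * ∫ ζ, (inner ℝ (B j) (Z ζ) : ℝ) ^ 2 ∂P :=
          Finset.sum_le_sum fun j _ => (hj j).2
      _ = (b : ℝ)⁻¹ * ∫ ζ, ‖Z ζ‖ ^ 2 ∂P := by
          rw [← Finset.mul_sum, ← integral_finsetSum _
            fun j _ => (hZ2.const_inner (B j)).integrable_sq]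
          simp only [hsum]
      _ ≤ (b : ℝ)⁻¹ * C ^ 2 := by
          gcongr
          calc ∫ ζ, ‖Z ζ‖ ^ 2 ∂P ≤ ∫ _, C ^ 2 ∂P := by
                refine integral_mono_ae hZ2.norm.integrable_sq (integrable_const _) ?_
                filter_upwards [hC] with ζ hζ
                exact pow_le_pow_left₀ (norm_nonneg _) hζ 2
            _ = C ^ 2 := by simp
  -- The weight `√b` balances both terms at order `1 / √b`, so the second moment controls the first;
  -- this produces the constant `C ^ 2 + 1`.
  have hamgm (ξ) : ‖err ξ‖ ≤ √b / 2 * ‖err ξ‖ ^ 2 + 1 / (2 * √b) := by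
    have h := sq_nonneg (√b * ‖err ξ‖ - 1)
    have h2 : √b / 2 * ‖err ξ‖ ^ 2 + 1 / (2 * √b) - ‖err ξ‖
        = (√b * ‖err ξ‖ - 1) ^ 2 / (2 * √b) := by
      field_simp
      ring
    have h3 := div_nonneg h (by positivity : 0 ≤ 2 * √(b : ℝ))
    linarith
  have hint2 : Integrable (fun ξ => √b / 2 * ‖err ξ‖ ^ 2 + 1 / (2 * √b))
      (Measure.pi fun _ => P) := (hint.const_mul _).add (integrable_const _)
  calc ∫⁻ ξ, ENNReal.ofReal ‖err ξ‖ ∂(Measure.pi fun _ => P)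
      ≤ ∫⁻ ξ, ENNReal.ofReal (√b / 2 * ‖err ξ‖ ^ 2 + 1 / (2 * √b)) ∂(Measure.pi fun _ => P) :=
        lintegral_mono fun ξ => ENNReal.ofReal_le_ofReal (hamgm ξ)
    _ = ENNReal.ofReal (∫ ξ, (√b / 2 * ‖err ξ‖ ^ 2 + 1 / (2 * √b)) ∂(Measure.pi fun _ => P)) :=
        (ofReal_integral_eq_lintegral_ofReal hint2 (ae_of_all _ fun ξ => by positivity)).symm
    _ ≤ _ := by
        refine ENNReal.ofReal_le_ofReal ?_
        rw [integral_add (hint.const_mul _) (integrable_const _), integral_const_mul]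
        simp only [integral_const, probReal_univ, one_smul]
        calc _ ≤ √b / 2 * ((b : ℝ)⁻¹ * C ^ 2) + 1 / (2 * √b) := by gcongr
          _ = _ := by
            have : (b : ℝ) = √b ^ 2 := (Real.sq_sqrt (Nat.cast_nonneg b)).symm
            nth_rw 2 [this]
            field_simp

end Batch

/-! ### Joint measurability of the minibatch error. -/

section Measurability

variable {E : Type*} [NormedAddCommGroup E] [NormedSpace ℝ E] [FiniteDimensional ℝ E]
  {M : Type*} [EMetricSpace M] [ChartedSpace E M] [IsManifold 𝓘(ℝ, E) ∞ M]
  [RiemannianBundle (fun x : M => TangentSpace 𝓘(ℝ, E) x)]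

/-- Glues chartwise formulas: finitely many charts cover the compact set. -/
lemma measurable_of_finset_cover {α β ι : Type*} [MeasurableSpace α] [MeasurableSpace β]
    {f : α → β} (t : Finset ι) (s : ι → Set α) (g : ι → α → β) (hs : ∀ i ∈ t, MeasurableSet (s i))
    (hg : ∀ i ∈ t, Measurable (g i)) (hcover : ∀ a, ∃ i ∈ t, a ∈ s i)
    (hfg : ∀ i ∈ t, EqOn f (g i) (s i)) : Measurable f := by
  intro B hB
  have h : f ⁻¹' B = ⋃ i ∈ t, s i ∩ g i ⁻¹' B := by
    ext a
    simp only [mem_preimage, mem_iUnion, mem_inter_iff, exists_prop]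
    constructor
    · intro ha
      obtain ⟨i, hi, hai⟩ := hcover a
      exact ⟨i, hi, hai, hfg i hi hai ▸ ha⟩
    · rintro ⟨i, hi, hai, ha⟩
      rwa [hfg i hi hai]
  rw [h]
  exact Finset.measurableSet_biUnion t fun i hi => (hs i hi).inter (hg i hi hB)

lemma measurable_indicator_of_continuousOn {α β : Type*} [TopologicalSpace α] [MeasurableSpace α]
    [OpensMeasurableSpace α] [TopologicalSpace β] [MeasurableSpace β] [BorelSpace β] [Zero β]
    {f : α → β} {s : Set α} (hs : IsOpen s) (hf : ContinuousOn f s) :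
    Measurable (s.indicator f) := by
  classical
  rw [← piecewise_eq_indicator]
  exact hf.measurable_piecewise continuousOn_const hs.measurableSet

variable [MeasurableSpace M] [BorelSpace M]

/-- Coordinates of tangent vectors in the chart at `p`, extended by zero. -/
def coordIndicator (p : M) : TangentBundle 𝓘(ℝ, E) M → E :=
  (trivializationAt E (fun x : M => TangentSpace 𝓘(ℝ, E) x) p).source.indicator (coord p)

lemma measurable_coordIndicator [MeasurableSpace E] [BorelSpace E] (p : M) :
    Measurable[borel (TangentBundle 𝓘(ℝ, E) M)] (coordIndicator (E := E) p) := by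
  let _ : MeasurableSpace (TangentBundle 𝓘(ℝ, E) M) := borel _
  have : BorelSpace (TangentBundle 𝓘(ℝ, E) M) := ⟨rfl⟩
  refine measurable_indicator_of_continuousOn
    (trivializationAt E (fun x : M => TangentSpace 𝓘(ℝ, E) x) p).open_source ?_
  exact continuous_snd.comp_continuousOn
    (trivializationAt E (fun x : M => TangentSpace 𝓘(ℝ, E) x) p).continuousOn

lemma symmL_coordIndicator {p x : M} (hx : x ∈ (chartAt E p).source)
    (v : TangentSpace 𝓘(ℝ, E) x) :
    (trivializationAt E (fun x : M => TangentSpace 𝓘(ℝ, E) x) p).symmL ℝ x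
      (coordIndicator p ⟨x, v⟩) = v := by
  rw [coordIndicator, indicator_of_mem (by simpa using hx), symmL_coord p hx]

lemma coordIndicator_eq {p x : M} (hx : x ∈ (chartAt E p).source)
    (v : TangentSpace 𝓘(ℝ, E) x) : coordIndicator p ⟨x, v⟩ =
      (trivializationAt E (fun x : M => TangentSpace 𝓘(ℝ, E) x) p).continuousLinearMapAt ℝ x v := by
  rw [coordIndicator, indicator_of_mem (by simpa using hx), coord_eq_continuousLinearMapAt p hx]

/-- The fibre norm varies with the base point; its joint continuity over the chart comes from that
of the bundle metric. -/
lemma measurable_norm_symmL [MeasurableSpace E] [BorelSpace E]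
    [IsContMDiffRiemannianBundle 𝓘(ℝ, E) ∞ E (fun x : M => TangentSpace 𝓘(ℝ, E) x)] (p : M) :
    Measurable (((chartAt E p).source ×ˢ univ).indicator fun q : M × E =>
      ‖(trivializationAt E (fun x : M => TangentSpace 𝓘(ℝ, E) x) p).symmL ℝ q.1 q.2‖) := by
  have : SecondCountableTopology E := secondCountable_of_proper
  refine measurable_indicator_of_continuousOn ((chartAt E p).open_source.prod isOpen_univ) ?_
  have hcont : ContinuousOn (fun q : M × E => (⟨q.1, (trivializationAt E
      (fun x : M => TangentSpace 𝓘(ℝ, E) x) p).symmL ℝ q.1 q.2⟩ : TangentBundle 𝓘(ℝ, E) M))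
      ((chartAt E p).source ×ˢ univ) := by
    refine ((trivializationAt E (fun x : M => TangentSpace 𝓘(ℝ, E) x) p).continuousOn_symm).congr ?_
    intro q hq
    exact congrArg (TotalSpace.mk q.1) (Trivialization.symmL_apply _ hq.1 q.2)
  have : IsContinuousRiemannianBundle E (fun x : M => TangentSpace 𝓘(ℝ, E) x) := by
    obtain ⟨g, hg, hgi⟩ := IsContMDiffRiemannianBundle.exists_contMDiff (IB := 𝓘(ℝ, E)) (n := ∞)
      (F := E) (E := fun x : M => TangentSpace 𝓘(ℝ, E) x)
    exact ⟨g, hg.continuous, hgi⟩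
  have h := Real.continuous_sqrt.comp_continuousOn (ContinuousOn.inner_bundle hcont hcont)
  refine h.congr fun q _ => ?_
  simp only [Function.comp_apply]
  exact norm_eq_sqrt_real_inner _

variable {Ξ : Type*} [MeasurableSpace Ξ] {P : Measure Ξ} {X : Set M} {φ : M → Ξ → ℝ}

lemma stronglyMeasurable_grad
    (hφmeas : Measurable[_, borel (TangentBundle 𝓘(ℝ, E) M)] (fun p : X × Ξ =>
      (⟨p.1, grad (fun z => φ z p.2) p.1⟩ : TangentBundle 𝓘(ℝ, E) M))) {x : M} (hx : x ∈ X) :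
    StronglyMeasurable (fun ξ => grad (E := E) (fun z => φ z ξ) x) := by
  borelize E
  have : SecondCountableTopology E := secondCountable_of_proper
  have h : Measurable fun ξ =>
      coordIndicator (E := E) x ⟨x, grad (E := E) (fun z => φ z ξ) x⟩ :=
    ((measurable_coordIndicator x).comp hφmeas).comp
      ((measurable_const (a := (⟨x, hx⟩ : X))).prodMk measurable_id)
  have h2 := ((trivializationAt E (fun x : M => TangentSpace 𝓘(ℝ, E) x) x).symmL ℝ
    x).continuous.comp_stronglyMeasurable h.stronglyMeasurable
  have h3 : (fun ξ => grad (E := E) (fun z => φ z ξ) x) = _ :=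
    funext fun ξ => (symmL_coordIndicator (mem_chart_source E x) _).symm
  rw [h3]
  exact h2

/-- The error of the minibatch gradient is a measurable function of the point and the samples. -/
lemma measurable_norm_batchError
    [IsContMDiffRiemannianBundle 𝓘(ℝ, E) ∞ E (fun x : M => TangentSpace 𝓘(ℝ, E) x)]
    [IsProbabilityMeasure P] (hXc : IsCompact X) {C : ℝ}
    (hφmeas : Measurable[_, borel (TangentBundle 𝓘(ℝ, E) M)] (fun p : X × Ξ =>
      (⟨p.1, grad (fun z => φ z p.2) p.1⟩ : TangentBundle 𝓘(ℝ, E) M)))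
    (hC : ∀ x ∈ X, ∀ᵐ ξ ∂P, ‖grad (E := E) (fun z => φ z ξ) x‖ ≤ C) (b : ℕ) :
    Measurable fun q : X × (Fin b → Ξ) =>
      ‖∫ ξ, grad (E := E) (fun z => φ z ξ) (q.1 : M) ∂P - batchGrad φ q.2 (q.1 : M)‖ := by
  borelize E
  have : SecondCountableTopology E := secondCountable_of_proper
  obtain ⟨t, -, ht⟩ := hXc.elim_nhds_subcover (fun p => (chartAt E p).source)
    fun p _ => chart_source_mem_nhds E p
  set c : M → X × Ξ → E := fun p q =>
    coordIndicator p ⟨q.1, grad (fun z => φ z q.2) q.1⟩ with hc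
  have hcm (p : M) : Measurable (c p) := (measurable_coordIndicator p).comp hφmeas
  -- Over each chart the fibre-valued integral and sum become `E`-valued, where parametrized
  -- integrals are measurable; `symmL` carries the result back to the fibre.
  refine measurable_of_finset_cover t (fun p => {q | (q.1 : M) ∈ (chartAt E p).source})
    (fun p q => ((chartAt E p).source ×ˢ univ).indicator (fun q : M × E =>
      ‖(trivializationAt E (fun x : M => TangentSpace 𝓘(ℝ, E) x) p).symmL ℝ q.1 q.2‖)
      (q.1, ∫ ξ, c p (q.1, ξ) ∂P - (b : ℝ)⁻¹ • ∑ i, c p (q.1, q.2 i))) ?_ ?_ ?_ ?_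
  · intro p _
    exact (measurable_subtype_coe.comp measurable_fst) (chartAt E p).open_source.measurableSet
  · intro p _
    have h1 : Measurable fun q : X × (Fin b → Ξ) => ∫ ξ, c p (q.1, ξ) ∂P :=
      ((hcm p).stronglyMeasurable.integral_prod_right'.measurable).comp measurable_fst
    have h2 : Measurable fun q : X × (Fin b → Ξ) => (b : ℝ)⁻¹ • ∑ i, c p (q.1, q.2 i) := by
      refine Measurable.const_smul (Finset.measurable_sum _ fun i _ => (hcm p).comp ?_) _
      exact measurable_fst.prodMk ((measurable_pi_apply i).comp measurable_snd)
    exact (measurable_norm_symmL p).comp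
      ((measurable_subtype_coe.comp measurable_fst).prodMk (h1.sub h2))
  · intro q
    obtain ⟨p, hp, hq⟩ := mem_iUnion₂.1 (ht q.1.2)
    exact ⟨p, hp, hq⟩
  · intro p _ q hq
    have hq' : (q.1 : M) ∈ (chartAt E p).source := hq
    set S := (trivializationAt E (fun x : M => TangentSpace 𝓘(ℝ, E) x) p).symmL ℝ (q.1 : M) with hS
    have hSc (ξ : Ξ) : S (c p (q.1, ξ)) = grad (E := E) (fun z => φ z ξ) (q.1 : M) :=
      symmL_coordIndicator hq' _
    have hint : Integrable (fun ξ => c p (q.1, ξ)) P := by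
      have hg : Integrable (fun ξ => grad (E := E) (fun z => φ z ξ) (q.1 : M)) P :=
        Integrable.of_bound (stronglyMeasurable_grad hφmeas q.1.2).aestronglyMeasurable C
          (hC q.1 q.1.2)
      have h2 := ContinuousLinearMap.integrable_comp ((trivializationAt E
        (fun x : M => TangentSpace 𝓘(ℝ, E) x) p).continuousLinearMapAt ℝ (q.1 : M)) hg
      refine h2.congr (ae_of_all _ fun ξ => ?_)
      exact (coordIndicator_eq hq' _).symm
    have hI : S (∫ ξ, c p (q.1, ξ) ∂P) = ∫ ξ, grad (E := E) (fun z => φ z ξ) (q.1 : M) ∂P := by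
      rw [← ContinuousLinearMap.integral_comp_comm S hint]
      simp only [hSc]
    beta_reduce
    rw [indicator_of_mem (mk_mem_prod hq' (mem_univ _))]
    simp only [map_sub, map_smul, map_sum, ← hS, hSc, hI, batchGrad]

end Measurability

/-! ### Error and oracle counts of an execution. -/

section Runs

variable {E : Type*} [NormedAddCommGroup E] [NormedSpace ℝ E] [FiniteDimensional ℝ E]
  {M : Type*} [EMetricSpace M] [ChartedSpace E M] [IsManifold 𝓘(ℝ, E) ∞ M]
  [RiemannianBundle (fun x : M => TangentSpace 𝓘(ℝ, E) x)]

variable [IsContMDiffRiemannianBundle 𝓘(ℝ, E) ∞ E (fun x : M => TangentSpace 𝓘(ℝ, E) x)]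
  [MeasurableSpace M] [BorelSpace M]
  {Ξ : Type*} [MeasurableSpace Ξ] {P : Measure Ξ} {X : Set M} {φ : M → Ξ → ℝ}

lemma measurable_norm_batchError_comp [IsProbabilityMeasure P] {C : ℝ} (hXc : IsCompact X)
    (hφmeas : Measurable[_, borel (TangentBundle 𝓘(ℝ, E) M)] (fun p : X × Ξ =>
      (⟨p.1, grad (fun z => φ z p.2) p.1⟩ : TangentBundle 𝓘(ℝ, E) M)))
    (hC : ∀ x ∈ X, ∀ᵐ ξ ∂P, ‖grad (E := E) (fun z => φ z ξ) x‖ ≤ C) {b : ℕ}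
    {Ω : Type*} {mΩ : MeasurableSpace Ω} {x : Ω → X} (hx : Measurable x) {ξ : Fin b → Ω → Ξ}
    (hξ : ∀ i, Measurable (ξ i)) :
    Measurable fun o => ‖∫ ξ, grad (E := E) (fun z => φ z ξ) (x o : M) ∂P
      - batchGrad φ (fun i => ξ i o) (x o : M)‖ := by
  have h : Measurable fun o => (x o, fun i => ξ i o) := hx.prodMk (measurable_pi_lambda _ hξ)
  have h2 := (measurable_norm_batchError hXc hφmeas hC b).comp h
  exact h2

namespace Run

variable {K : ℕ} {b : ℕ → ℕ} {η : ℕ → ℝ} {Ω : Type*} [mΩ : MeasurableSpace Ω] {μ : Measure Ω}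

lemma x_mem (r : Run E X φ P K b η μ) (hη : ∀ k < K, η k ∈ Icc (0 : ℝ) 1) {k : ℕ} (hk : k ≤ K)
    (o : Ω) : r.x k o ∈ X := by
  cases k with
  | zero => exact r.init o
  | succ k =>
    obtain ⟨γ, hγ, h⟩ := r.step k hk o
    exact h ▸ hγ.mem _ (hη k hk)

lemma measurable_x_subtype (r : Run E X φ P K b η μ) (hη : ∀ k < K, η k ∈ Icc (0 : ℝ) 1) {k : ℕ}
    (hk : k ≤ K) : Measurable[r.ℱ k] (fun o => (⟨r.x k o, r.x_mem hη hk o⟩ : X)) :=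
  (r.measurable_x k hk).subtype_mk

/-- The norm of the error of the minibatch gradient at iteration `k`. -/
def batchError (r : Run E X φ P K b η μ) (k : ℕ) (o : Ω) : ℝ :=
  ‖∫ ξ, grad (E := E) (fun z => φ z ξ) (r.x k o) ∂P
    - batchGrad φ (fun i => r.ξ k i o) (r.x k o)‖

variable [IsProbabilityMeasure P] {C : ℝ}

lemma measurable_batchError (r : Run E X φ P K b η μ) (hη : ∀ k < K, η k ∈ Icc (0 : ℝ) 1)
    (hXc : IsCompact X)
    (hφmeas : Measurable[_, borel (TangentBundle 𝓘(ℝ, E) M)] (fun p : X × Ξ =>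
      (⟨p.1, grad (fun z => φ z p.2) p.1⟩ : TangentBundle 𝓘(ℝ, E) M)))
    (hC : ∀ x ∈ X, ∀ᵐ ξ ∂P, ‖grad (E := E) (fun z => φ z ξ) x‖ ≤ C) {k : ℕ} (hk : k < K) :
    Measurable[r.ℱ (k + 1)] (r.batchError k) := by
  have h1 : Measurable[r.ℱ (k + 1)] (fun o => (⟨r.x k o, r.x_mem hη hk.le o⟩ : X)) :=
    (r.measurable_x_subtype hη hk.le).mono (r.ℱ.mono k.le_succ) le_rfl
  exact measurable_norm_batchError_comp (mΩ := r.ℱ (k + 1)) hXc hφmeas hC h1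
    (r.measurable_ξ k hk)

/-- The iterate depends on the past only, so the joint law of iterate and batch is a product.
Tonelli then reduces to a fixed point, without conditional expectations. -/
lemma lintegral_batchError_le [IsProbabilityMeasure μ] (r : Run E X φ P K b η μ)
    (hη : ∀ k < K, η k ∈ Icc (0 : ℝ) 1) (hXc : IsCompact X)
    (hφmeas : Measurable[_, borel (TangentBundle 𝓘(ℝ, E) M)] (fun p : X × Ξ =>
      (⟨p.1, grad (fun z => φ z p.2) p.1⟩ : TangentBundle 𝓘(ℝ, E) M)))
    (hC : ∀ x ∈ X, ∀ᵐ ξ ∂P, ‖grad (E := E) (fun z => φ z ξ) x‖ ≤ C) {k : ℕ} (hk : k < K)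
    (hb : 0 < b k) :
    ∫⁻ o, ENNReal.ofReal (r.batchError k o) ∂μ
      ≤ ENNReal.ofReal ((C ^ 2 + 1) / (2 * √(b k : ℝ))) := by
  set x' : Ω → X := fun o => ⟨r.x k o, r.x_mem hη hk.le o⟩ with hx'
  set ξ' : Ω → Fin (b k) → Ξ := fun o i => r.ξ k i o with hξ'
  have hx'm : Measurable[r.ℱ k] x' := r.measurable_x_subtype hη hk.le
  have hx'm0 : Measurable x' := hx'm.mono (r.ℱ.le k) le_rfl
  have hξi (i) : Measurable (r.ξ k i) := (r.measurable_ξ k hk i).mono (r.ℱ.le _) le_rfl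
  have hξ'm : Measurable ξ' := measurable_pi_iff.2 hξi
  have hind : IndepFun x' ξ' μ :=
    (indep_of_indep_of_le_right (r.indep_past k hk) hx'm.comap_le).symm
  have hlaw : μ.map ξ' = Measure.pi fun _ => P := by
    have h := (iIndepFun_iff_map_fun_eq_pi_map fun i => (hξi i).aemeasurable).1 (r.iIndep_ξ k hk)
    simpa only [r.law_ξ k hk] using h
  have hjoint := (indepFun_iff_map_prod_eq_prod_map_map hx'm0.aemeasurable hξ'm.aemeasurable).1 hind
  rw [hlaw] at hjoint
  set F : X × (Fin (b k) → Ξ) → ℝ≥0∞ := fun q =>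
    ENNReal.ofReal ‖∫ ξ, grad (E := E) (fun z => φ z ξ) (q.1 : M) ∂P
      - batchGrad φ q.2 (q.1 : M)‖ with hF
  have hmeas : Measurable F := (measurable_norm_batchError hXc hφmeas hC (b k)).ennreal_ofReal
  have : IsProbabilityMeasure (μ.map x') := Measure.isProbabilityMeasure_map hx'm0.aemeasurable
  have hFo (o : Ω) : ENNReal.ofReal (r.batchError k o) = F (x' o, ξ' o) := rfl
  simp only [hFo]
  rw [← lintegral_map hmeas (hx'm0.prodMk hξ'm), hjoint, lintegral_prod _ hmeas.aemeasurable]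
  calc ∫⁻ x, ∫⁻ ξ, F (x, ξ) ∂(Measure.pi fun _ => P) ∂(μ.map x')
      ≤ ∫⁻ _, ENNReal.ofReal ((C ^ 2 + 1) / (2 * √(b k : ℝ))) ∂(μ.map x') := by
        refine lintegral_mono fun x => ?_
        have : FiniteDimensional ℝ (TangentSpace 𝓘(ℝ, E) (x : M)) :=
          inferInstanceAs (FiniteDimensional ℝ E)
        exact lintegral_norm_batch_le (stronglyMeasurable_grad hφmeas x.2).aestronglyMeasurable
          (hC x x.2) hb
    _ = _ := by simp

lemma countP_callsAt (r : Run E X φ P K b η μ) (o : Ω) (k : ℕ) :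
    (r.callsAt o k).countP (fun c => c.isSFO) = b k ∧
      (r.callsAt o k).countP (fun c => !c.isSFO) = 1 := by
  have h1 : ∀ c ∈ List.ofFn (fun i => (OracleCall.sfo (r.x k o) (r.ξ k i o) : OracleCall E M Ξ)),
      c.isSFO = true := by
    intro c hc
    obtain ⟨i, rfl⟩ := (List.mem_ofFn' _ _).1 hc
    rfl
  rw [callsAt, List.countP_append, List.countP_append]
  constructor
  · rw [List.countP_eq_length.2 h1]
    simp [OracleCall.isSFO]
  · rw [List.countP_eq_zero.2 fun c hc => by simp [h1 c hc]]
    simp [OracleCall.isSFO]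

lemma sfoCalls_eq (r : Run E X φ P K b η μ) (o : Ω) :
    r.sfoCalls o = ∑ k ∈ Finset.range K, b k := by
  simp only [sfoCalls, transcript, List.countP_flatMap, Function.comp_def, (r.countP_callsAt o _).1]
  rfl

lemma rloCalls_eq (r : Run E X φ P K b η μ) (o : Ω) : r.rloCalls o = K := by
  simp [rloCalls, transcript, List.countP_flatMap, Function.comp_def, (r.countP_callsAt o _).2]

end Run

end Runs

/-! ### Averaging over the iterations. -/

section Convergence

variable {E : Type*} [NormedAddCommGroup E] [NormedSpace ℝ E] [FiniteDimensional ℝ E]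
  {M : Type*} [EMetricSpace M] [ChartedSpace E M] [IsManifold 𝓘(ℝ, E) ∞ M]
  [RiemannianBundle (fun x : M => TangentSpace 𝓘(ℝ, E) x)]

variable [IsContMDiffRiemannianBundle 𝓘(ℝ, E) ∞ E (fun x : M => TangentSpace 𝓘(ℝ, E) x)]
  [MeasurableSpace M] [BorelSpace M]
  {Ξ : Type*} [MeasurableSpace Ξ] {P : Measure Ξ} {X : Set M} {φ : M → Ξ → ℝ}

namespace Run

variable {K : ℕ} {b : ℕ → ℕ} {η : ℕ → ℝ} {Ω : Type*} [mΩ : MeasurableSpace Ω] {μ : Measure Ω}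

/-- The expectation of a nonnegative quantity at the output is the mean of its expectations along
the iterations. -/
lemma lintegral_output_le [IsProbabilityMeasure μ] (r : Run E X φ P K b η μ) (G : M → ℝ≥0∞)
    (h : ℕ → Ω → ℝ≥0∞) (hmeas : ∀ k < K, Measurable[r.ℱ K] (h k))
    (hG : ∀ k < K, ∀ o, G (r.x k o) ≤ h k o) :
    ∫⁻ o, G (r.output o) ∂μ ≤ (K : ℝ≥0∞)⁻¹ * ∑ k ∈ Finset.range K, ∫⁻ o, h k o ∂μ := by
  have hJ (j : Fin K) : MeasurableSet (r.J ⁻¹' {j}) := r.measurable_J (measurableSet_singleton j)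
  have hJm (j : Fin K) : Measurable[MeasurableSpace.comap r.J ⊤]
      ((r.J ⁻¹' {j}).indicator (fun _ => (1 : ℝ≥0∞))) :=
    measurable_const.indicator ⟨{j}, trivial, rfl⟩
  have hle : MeasurableSpace.comap r.J ⊤ ≤ mΩ := r.measurable_J.comap_le
  -- Measurability of `G` is never needed: it is dominated by the measurable `h k` before sums and
  -- integrals are exchanged.
  calc ∫⁻ o, G (r.output o) ∂μ
      ≤ ∫⁻ o, ∑ j : Fin K, (r.J ⁻¹' {j}).indicator (fun _ => (1 : ℝ≥0∞)) o * h j o ∂μ := by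
        refine lintegral_mono fun o => ?_
        refine le_trans ?_ (Finset.single_le_sum (fun _ _ => zero_le) (Finset.mem_univ (r.J o)))
        simpa [output] using hG (r.J o) (r.J o).2 o
    _ = ∑ j : Fin K, ∫⁻ o, (r.J ⁻¹' {j}).indicator (fun _ => (1 : ℝ≥0∞)) o * h j o ∂μ :=
        lintegral_finsetSum _ fun j _ => ((hJm j).mono hle le_rfl).mul
          ((hmeas j j.2).mono (r.ℱ.le K) le_rfl)
    _ = ∑ j : Fin K, (K : ℝ≥0∞)⁻¹ * ∫⁻ o, h j o ∂μ := by
        refine Finset.sum_congr rfl fun j _ => ?_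
        rw [lintegral_mul_eq_lintegral_mul_lintegral_of_independent_measurableSpace hle (r.ℱ.le K)
          r.indep_J (hJm j) (hmeas j j.2), lintegral_indicator_const (hJ j), one_mul,
          r.uniform_J]
    _ = _ := by
        rw [← Finset.mul_sum, Fin.sum_univ_eq_sum_range (fun k => ∫⁻ o, h k o ∂μ)]

variable [IsProbabilityMeasure P] {C : ℝ}

/-- The expected Frank-Wolfe gap of the output of a run with constant batch and step sizes. -/
lemma lintegral_fwGap_output_le [IsRiemannianManifold 𝓘(ℝ, E) M] [IsProbabilityMeasure μ]
    {b : ℕ} {η : ℝ} (r : Run E X φ P K (fun _ => b) (fun _ => η) μ)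
    (hK : 0 < K) (hb : 0 < b) (hη : 0 < η) (hη1 : η ≤ 1)
    (hXc : IsCompact X) (hX : IsGeodesicallyConvex E X)
    (hφmeas : Measurable[_, borel (TangentBundle 𝓘(ℝ, E) M)] (fun p : X × Ξ =>
      (⟨p.1, grad (fun z => φ z p.2) p.1⟩ : TangentBundle 𝓘(ℝ, E) M)))
    (hC : ∀ x ∈ X, ∀ᵐ ξ ∂P, ‖grad (E := E) (fun z => φ z ξ) x‖ ≤ C)
    {f : M → ℝ} (hunbiased : ∀ x ∈ X, ∫ ξ, grad (E := E) (fun z => φ z ξ) x ∂P = grad f x)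
    {L : ℝ} (hL : IsLSmoothOn E X f L) {D : ℝ} (hD0 : 0 ≤ D)
    (hD : ∀ x ∈ X, ∀ y ∈ X, (edist x y).toReal ≤ D) {B : ℝ} (hB : ∀ x ∈ X, |f x| ≤ B) :
    ∫⁻ o, ENNReal.ofReal (fwGap E X f (r.output o)) ∂μ
      ≤ ENNReal.ofReal (2 * B / (K * η) + |L| * D ^ 2 * η / 2 + D * (C ^ 2 + 1) / √b) := by
  have hηI : ∀ k < K, (fun _ : ℕ => η) k ∈ Icc (0 : ℝ) 1 := fun _ _ => ⟨hη.le, hη1⟩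
  have hmem {k : ℕ} (hk : k ≤ K) (o : Ω) : r.x k o ∈ X := r.x_mem hηI hk o
  set h : ℕ → Ω → ℝ := fun k o => (f (r.x k o) - f (r.x (k + 1) o)) / η + |L| * D ^ 2 * η / 2
    + 2 * D * r.batchError k o with hh
  have hfm {k : ℕ} (hk : k ≤ K) : Measurable[r.ℱ K] (fun o => f (r.x k o)) := by
    have h1 : Continuous fun x : X => f x :=
      (ContinuousOn.domRestrict fun x hx => (hL.1 x hx).continuousAt.continuousWithinAt)
    exact h1.measurable.comp ((r.measurable_x_subtype hηI hk).mono (r.ℱ.mono hk) le_rfl)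
  have hem {k : ℕ} (hk : k < K) : Measurable[r.ℱ K] (r.batchError k) :=
    (r.measurable_batchError hηI hXc hφmeas hC hk).mono (r.ℱ.mono hk) le_rfl
  have hfi {k : ℕ} (hk : k ≤ K) : Integrable (fun o => f (r.x k o)) μ :=
    Integrable.of_bound ((hfm hk).mono (r.ℱ.le K) le_rfl).aestronglyMeasurable B
      (ae_of_all _ fun o => hB _ (hmem hk o))
  have he0 (k : ℕ) (o : Ω) : 0 ≤ r.batchError k o := norm_nonneg _
  have hel {k : ℕ} (hk : k < K) := r.lintegral_batchError_le hηI hXc hφmeas hC hk hb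
  have hei {k : ℕ} (hk : k < K) : Integrable (r.batchError k) μ := by
    refine ⟨((hem hk).mono (r.ℱ.le K) le_rfl).aestronglyMeasurable, ?_⟩
    rw [hasFiniteIntegral_iff_ofReal (ae_of_all _ (he0 k))]
    exact (hel hk).trans_lt ENNReal.ofReal_lt_top
  have heI {k : ℕ} (hk : k < K) : ∫ o, r.batchError k o ∂μ ≤ (C ^ 2 + 1) / (2 * √(b : ℝ)) := by
    rw [integral_eq_lintegral_of_nonneg_ae (ae_of_all _ (he0 k)) (hei hk).aestronglyMeasurable]
    exact ENNReal.toReal_le_of_le_ofReal (by positivity) (hel hk)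
  have hgap {k : ℕ} (hk : k < K) (o : Ω) : fwGap E X f (r.x k o) ≤ h k o := by
    obtain ⟨γ, hγ, hstep⟩ := r.step k hk o
    have := fwGap_le_of_step hX hD hL (hmem hk.le o) (r.linear_oracle k hk o) hγ hη hη1
    rw [← hstep, ← hunbiased _ (hmem hk.le o)] at this
    exact this
  -- Nonnegativity of the gap passes to its upper bound, so the real integrals, which telescope, can
  -- replace the extended ones.
  have hh0 {k : ℕ} (hk : k < K) (o : Ω) : 0 ≤ h k o :=
    (fwGap_nonneg hX hD f (hmem hk.le o)).trans (hgap hk o)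
  have hhi {k : ℕ} (hk : k < K) : Integrable (h k) μ :=
    ((((hfi hk.le).sub (hfi hk)).div_const η).add (integrable_const _)).add
      ((hei hk).const_mul _)
  have hhI {k : ℕ} (hk : k < K) : ∫ o, h k o ∂μ ≤
      (∫ o, f (r.x k o) ∂μ - ∫ o, f (r.x (k + 1) o) ∂μ) / η
        + (|L| * D ^ 2 * η / 2 + D * (C ^ 2 + 1) / √b) := by
    have h1 : ∫ o, h k o ∂μ = (∫ o, f (r.x k o) ∂μ - ∫ o, f (r.x (k + 1) o) ∂μ) / η
        + |L| * D ^ 2 * η / 2 + 2 * D * ∫ o, r.batchError k o ∂μ := by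
      have e1 : Integrable (fun o => (f (r.x k o) - f (r.x (k + 1) o)) / η) μ :=
        ((hfi hk.le).sub (hfi hk)).div_const η
      have e2 : Integrable (fun o => (f (r.x k o) - f (r.x (k + 1) o)) / η
        + |L| * D ^ 2 * η / 2) μ := e1.add (integrable_const _)
      change ∫ o, ((f (r.x k o) - f (r.x (k + 1) o)) / η + |L| * D ^ 2 * η / 2
        + 2 * D * r.batchError k o) ∂μ = _
      rw [integral_add e2 ((hei hk).const_mul _), integral_add e1 (integrable_const _),
        integral_div, integral_sub (hfi hk.le) (hfi hk), integral_const_mul]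
      simp
    rw [h1, add_assoc]
    have h2 := mul_le_mul_of_nonneg_left (heI hk) (by positivity : 0 ≤ 2 * D)
    have h3 : 2 * D * ((C ^ 2 + 1) / (2 * √(b : ℝ))) = D * (C ^ 2 + 1) / √b := by
      have : 0 < √(b : ℝ) := by positivity
      field_simp
    linarith
  have hfB {k : ℕ} (hk : k ≤ K) : |∫ o, f (r.x k o) ∂μ| ≤ B := by
    have := norm_integral_le_of_norm_le_const (μ := μ) (f := fun o => f (r.x k o))
      (ae_of_all _ fun o => hB _ (hmem hk o))
    simpa using this
  have hsum : ∑ k ∈ Finset.range K, ∫ o, h k o ∂μ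
      ≤ 2 * B / η + K * (|L| * D ^ 2 * η / 2 + D * (C ^ 2 + 1) / √b) := by
    calc ∑ k ∈ Finset.range K, ∫ o, h k o ∂μ
        ≤ ∑ k ∈ Finset.range K, ((∫ o, f (r.x k o) ∂μ - ∫ o, f (r.x (k + 1) o) ∂μ) / η
          + (|L| * D ^ 2 * η / 2 + D * (C ^ 2 + 1) / √b)) :=
          Finset.sum_le_sum fun k hk => hhI (Finset.mem_range.1 hk)
      _ = (∫ o, f (r.x 0 o) ∂μ - ∫ o, f (r.x K o) ∂μ) / η
          + K * (|L| * D ^ 2 * η / 2 + D * (C ^ 2 + 1) / √b) := by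
          rw [Finset.sum_add_distrib, ← Finset.sum_div,
            Finset.sum_range_sub' (fun k => ∫ o, f (r.x k o) ∂μ)]
          simp [mul_add]
      _ ≤ _ := by
          gcongr
          linarith [(abs_le.1 (hfB hK.le)).1, (abs_le.1 (hfB hK.le)).2,
            (abs_le.1 (hfB le_rfl)).1, (abs_le.1 (hfB (Nat.zero_le K))).2]
  have hK0 : (0 : ℝ) < K := by exact_mod_cast hK
  calc ∫⁻ o, ENNReal.ofReal (fwGap E X f (r.output o)) ∂μ
      ≤ (K : ℝ≥0∞)⁻¹ * ∑ k ∈ Finset.range K, ∫⁻ o, ENNReal.ofReal (h k o) ∂μ := by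
        refine r.lintegral_output_le (fun x => ENNReal.ofReal (fwGap E X f x))
          (fun k o => ENNReal.ofReal (h k o)) (fun k hk => ?_)
          fun k hk o => ENNReal.ofReal_le_ofReal (hgap hk o)
        exact (((((hfm hk.le).sub (hfm hk)).div_const η).add measurable_const).add
          ((hem hk).const_mul _)).ennreal_ofReal
    _ = ENNReal.ofReal ((K : ℝ)⁻¹ * ∑ k ∈ Finset.range K, ∫ o, h k o ∂μ) := by
        rw [ENNReal.ofReal_mul (by positivity), ENNReal.ofReal_inv_of_pos hK0,
          ENNReal.ofReal_natCast, ENNReal.ofReal_sum_of_nonneg fun k hk =>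
            integral_nonneg (hh0 (Finset.mem_range.1 hk))]
        congr 1
        refine Finset.sum_congr rfl fun k hk => ?_
        exact (ofReal_integral_eq_lintegral_ofReal (hhi (Finset.mem_range.1 hk))
          (ae_of_all _ (hh0 (Finset.mem_range.1 hk)))).symm
    _ ≤ _ := by
        refine ENNReal.ofReal_le_ofReal ?_
        calc _ ≤ (K : ℝ)⁻¹ * (2 * B / η + K * (|L| * D ^ 2 * η / 2 + D * (C ^ 2 + 1) / √b)) := by
              gcongr
          _ = _ := by
              field_simp
              ring

end Run

/-- `K` is the ceiling of `((B + 1) / ε) ^ 2`. Taking `B + 1` and `ε ≤ 1` makes that number at least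
`1`, so rounding up at most doubles it. -/
lemma exists_iterations {B : ℝ} (hB : 0 ≤ B) {ε : ℝ} (hε : 0 < ε) (hε1 : ε ≤ 1) :
    ∃ K : ℕ, 0 < K ∧ B / √(K : ℝ) ≤ ε ∧ (K : ℝ) ≤ 2 * (B + 1) ^ 2 / ε ^ 2 := by
  have hpos : 0 < ((B + 1) / ε) ^ 2 := by positivity
  have h1 : 1 ≤ ((B + 1) / ε) ^ 2 := by
    refine one_le_pow₀ ?_
    rw [le_div_iff₀ hε]
    linarith
  refine ⟨⌈((B + 1) / ε) ^ 2⌉₊, Nat.ceil_pos.2 hpos, ?_, ?_⟩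
  · have h2 : (B + 1) / ε ≤ √(⌈((B + 1) / ε) ^ 2⌉₊ : ℝ) := Real.le_sqrt_of_sq_le (Nat.le_ceil _)
    have h3 : 0 < (B + 1) / ε := by positivity
    rw [div_le_iff₀ (h3.trans_le h2)]
    rw [div_le_iff₀ hε] at h2
    linarith
  · have h2 := (Nat.ceil_lt_add_one hpos.le).le
    calc (⌈((B + 1) / ε) ^ 2⌉₊ : ℝ) ≤ 2 * ((B + 1) / ε) ^ 2 := by linarith
      _ = _ := by rw [div_pow, mul_div_assoc]

end Convergence

end SRFW

end

theorem mainTheorem8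
    {E : Type*} [NormedAddCommGroup E] [NormedSpace ℝ E] [FiniteDimensional ℝ E]
    {M : Type*} [EMetricSpace M] [ChartedSpace E M] [IsManifold 𝓘(ℝ, E) ∞ M]
    [RiemannianBundle (fun x : M => TangentSpace 𝓘(ℝ, E) x)]
    [IsContMDiffRiemannianBundle 𝓘(ℝ, E) ∞ E (fun x : M => TangentSpace 𝓘(ℝ, E) x)]
    [IsRiemannianManifold 𝓘(ℝ, E) M]
    [MeasurableSpace M] [BorelSpace M]
    {Ξ : Type*} [MeasurableSpace Ξ] (P : Measure Ξ) [IsProbabilityMeasure P]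
    (X : Set M) (hXc : IsCompact X) (hXg : SRFW.IsGeodesicallyConvex E X)
    (φ : M → Ξ → ℝ) (L C : ℝ)
    (hφint : ∀ x, Integrable (φ x) P)
    (hφdiff : ∀ x ∈ X, ∀ᵐ ξ ∂P, MDifferentiableAt 𝓘(ℝ, E) 𝓘(ℝ, ℝ) (fun z => φ z ξ) x)
    (hφmeas : Measurable[_, borel (TangentBundle 𝓘(ℝ, E) M)] (fun p : X × Ξ =>
      (⟨p.1, SRFW.grad (fun z => φ z p.2) p.1⟩ : TangentBundle 𝓘(ℝ, E) M)))
    (hC : ∀ x ∈ X, ∀ᵐ ξ ∂P, ‖SRFW.grad (E := E) (fun z => φ z ξ) x‖ ≤ C)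
    (hunbiased : ∀ x ∈ X, ∫ ξ, SRFW.grad (E := E) (fun z => φ z ξ) x ∂P
      = SRFW.grad (fun z => ∫ ξ, φ z ξ ∂P) x)
    (hL : SRFW.IsLSmoothOn E X (fun z => ∫ ξ, φ z ξ ∂P) L) :
    ∃ A : ℝ, ∀ ε : ℝ, 0 < ε → ε ≤ 1 → ∃ K : ℕ, 0 < K ∧
      ∀ {Ω : Type*} [MeasurableSpace Ω] (μ : Measure Ω) [IsProbabilityMeasure μ]
        (r : SRFW.Run E X φ P K (fun _ => K) (fun _ => 1 / √(K : ℝ)) μ),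
        ∫⁻ o, ENNReal.ofReal (SRFW.fwGap E X (fun z => ∫ ξ, φ z ξ ∂P) (r.output o)) ∂μ
            ≤ ENNReal.ofReal ε ∧
        (∀ o, (r.sfoCalls o : ℝ) ≤ A / ε ^ 4) ∧
        (∀ o, (r.rloCalls o : ℝ) ≤ A / ε ^ 2) := by
  obtain ⟨D, hD0, hD⟩ := SRFW.exists_edist_le hXc hXg
  obtain ⟨B, hB⟩ := hXc.exists_bound_of_continuousOn (f := fun z => ∫ ξ, φ z ξ ∂P)
    fun x hx => (hL.1 x hx).continuousAt.continuousWithinAt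
  set R : ℝ := 2 * |B| + |L| * D ^ 2 / 2 + D * (C ^ 2 + 1) with hR
  -- For `b = K` and `η = 1 / √K` the gap bound is exactly `R / √K`. The absolute value of `B`
  -- matters when `X` is empty, where `B` may be negative.
  have hR0 : 0 ≤ R := by positivity
  -- The square of `2 * (R + 1) ^ 2`, since the gradient calls number `K ^ 2`; as `R + 1 ≥ 1`, it
  -- also covers the `K` linear oracle calls.
  refine ⟨4 * (R + 1) ^ 4, fun ε hε hε1 => ?_⟩
  obtain ⟨K, hK, hKε, hKle⟩ := SRFW.exists_iterations hR0 hε hε1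
  refine ⟨K, hK, fun μ _ r => ⟨?_, fun o => ?_, fun o => ?_⟩⟩
  · have hK1 : (1 : ℝ) ≤ K := by exact_mod_cast hK
    have hs : 1 ≤ √(K : ℝ) := Real.one_le_sqrt.2 hK1
    refine (r.lintegral_fwGap_output_le hK hK (by positivity)
      ((div_le_one (by positivity)).2 hs) hXc hXg hφmeas hC hunbiased hL hD0 hD
      fun x hx => (hB x hx).trans (le_abs_self B)).trans (ENNReal.ofReal_le_ofReal ?_)
    refine le_of_eq_of_le ?_ hKε
    have hs0 : √(K : ℝ) ≠ 0 := by positivity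
    have h1 : (K : ℝ) * (1 / √(K : ℝ)) = √(K : ℝ) := by
      rw [mul_one_div, Real.div_sqrt]
    rw [h1, hR]
    field_simp
  · have h1 : (r.sfoCalls o : ℝ) = (K : ℝ) ^ 2 := by
      rw [r.sfoCalls_eq]
      simp [sq]
    rw [h1]
    calc (K : ℝ) ^ 2 ≤ (2 * (R + 1) ^ 2 / ε ^ 2) ^ 2 := by gcongr
      _ = 4 * (R + 1) ^ 4 / ε ^ 4 := by ring
  · rw [r.rloCalls_eq]
    refine hKle.trans ?_
    have h1 : 1 ≤ (R + 1) ^ 2 := one_le_pow₀ (by linarith)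
    have h2 : 2 * (R + 1) ^ 2 ≤ 4 * (R + 1) ^ 4 := by nlinarith
    gcongr
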